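/- **Theorem (generating functional).** Let $W=(W^1,\dots,W^N)$ be an $N$-dimensional Brownian motion on a probability space $(\Omega,\mathcal F,P)$ and let $\mathcal F_\infty$ be the $\sigma$-algebra generated by $(W_t)_{t\ge 0}$ (up to $P$-null sets). Let $\Delta=\mathbb R_+\times\{1,\dots,N\}$ with $\int_\Delta f(\tau)\,d\tau=\sum_\mu\int_0^\infty f(s,\mu)\,ds$, and let $\Delta_n=\{(\tau_1,\dots,\tau_n)\in\Delta^n:\tau_i=(s_i,\mu_i),\ s_1\le\dots\le s_n\}$. All $L^2$ spaces are complex. For $h\in L^2(\Delta)$ let $W(h)=\int_\Delta h(\tau)\,dW_\tau$ be the (complex-linear) Wiener integral, and for $f\in L^2(\Delta_n)$ let $J_n(f)=\int_{\Delta_n}f(\tau_1,\dots,\tau_n)\,dW_{\tau_1}\cdots dW_{\tau_n}$ be the iterated stochastic integral, i.e. the continuous linear extension to $L^2(\Delta_n)$ of $J_n\bigl(\mathbf 1_{\prod_i (a_i,b_i]\times\{\mu_i\}}\bigr)=\prod_i\bigl(W^{\mu_i}_{b_i}-W^{\mu_i}_{a_i}\bigr)$, where $a_1\le b_1\le a_2\le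 b_2\le\dots\le a_n\le b_n$. Let $X\in L^2(\Omega,\mathcal F_\infty,P)$. Then for every $h\in L^2(\Delta)$ the random variable $X\exp\bigl[W(h)-\tfrac12\int_\Delta h(\tau)^2\,d\tau\bigr]$ is integrable, and the generating functional $$Z_X(h)=E\Bigl[X\exp\Bigl(W(h)-\tfrac12\int_\Delta h(\tau)^2\,d\tau\Bigr)\Bigr]$$ is an entire analytic functional $L^2(\Delta)\to\mathbb C$. For every $n\ge 0$ the $n$-th Fréchet derivative of $Z_X$ at $0$ is given by a unique square integrable kernel $f_X^{(n)}\in L^2(\Delta^n)$, that is, $$D^nZ_X(0)[v_1,\dots,v_n]=\int_{\Delta^n}f_X^{(n)}(\tau_1,\dots,\tau_n)\,v_1(\tau_1)\cdots v_n(\tau_n)\,d\tau_1\cdots d\tau_n\qquad(v_1,\dots,v_n\in L^2(\Delta)).$$ For every $h\in L^2(\Delta)$ there is the absolutely convergent expansion $$Z_X(h)=\sum_{n\ge 0}F_X^{(n)}(h),\qquad F_X^{(n)}(h)=\int_{\Delta_n}f_X^{(n)}(\tau_1,\dots,\tau_n)\,h(\tau_1)\cdots h(\tau_n)\,d\tau_1\cdots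 d\tau_n.$$ Finally, the restrictions of the $f_X^{(n)}$ to $\Delta_n$ are exactly the kernels of the Wiener–Itô chaos expansion of $X$: with convergence in $L^2(\Omega,P)$, $$X=\sum_{n\ge 0}\int_{\Delta_n}f_X^{(n)}(\tau_1,\dots,\tau_n)\,dW_{\tau_1}\cdots dW_{\tau_n},$$ and if $X=\sum_{n\ge 0}J_n(g_n)$ in $L^2(\Omega,P)$ with $g_n\in L^2(\Delta_n)$, then $g_n=f_X^{(n)}|_{\Delta_n}$ for every $n$. -/

import Mathlib

open MeasureTheory ProbabilityTheory
open scoped NNReal ENNReal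

namespace WienerChaos

noncomputable section

/-- `W = (W^μ)_{μ < N}` is an `N`-dimensional Brownian motion on `(Ω, P)`: its components are
independent standard real Brownian motions (started at `0`, with a.s. continuous paths). -/
structure IsBrownianMotion {Ω : Type*} [MeasurableSpace Ω] {N : ℕ}
    (W : Fin N → ℝ≥0 → Ω → ℝ) (P : Measure Ω) : Prop where
  measurable : ∀ μ t, Measurable (W μ t)
  isBrownianReal : ∀ μ, IsBrownianReal (W μ) P
  indep : iIndepFun (fun μ ω t => W μ t ω) P

/-- The σ-algebra `ℱ_∞` generated by the whole Brownian path. -/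
abbrev sigmaInfty {Ω : Type*} {N : ℕ} (W : Fin N → ℝ≥0 → Ω → ℝ) : MeasurableSpace Ω :=
  ⨆ (μ : Fin N) (t : ℝ≥0), MeasurableSpace.comap (W μ t) inferInstance

/-- The space `Δ = ℝ₊ × {1, …, N}`. -/
abbrev Δ (N : ℕ) : Type := ℝ≥0 × Fin N

/-- The measure `dτ` on `Δ`: Lebesgue measure on `ℝ₊` times counting measure, so that
`∫_Δ f(τ) dτ = ∑_μ ∫_0^∞ f(s, μ) ds`. -/
def dτ (N : ℕ) : Measure (Δ N) :=
  (Measure.comap ((↑) : ℝ≥0 → ℝ) volume).prod Measure.count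

/-- The product measure `dτ₁ ⋯ dτₙ` on `Δⁿ`. -/
def dτPow (N n : ℕ) : Measure (Fin n → Δ N) := Measure.pi (fun _ => dτ N)

/-- The ordered region `Δ_n = {(τ₁, …, τₙ) : s₁ ≤ ⋯ ≤ sₙ}` where `τᵢ = (sᵢ, μᵢ)`. -/
def simplex (N n : ℕ) : Set (Fin n → Δ N) := {τ | Monotone fun i => (τ i).1}

/-- The complex Hilbert space `L²(Δ)`. -/
abbrev L2Δ (N : ℕ) : Type := Lp ℂ 2 (dτ N)

/-- The complex Hilbert space `L²(Δⁿ)`. -/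
abbrev L2Pow (N n : ℕ) : Type := Lp ℂ 2 (dτPow N n)

/-- The complex Hilbert space `L²(Δ_n)`, with `Δ_n` the ordered region. -/
abbrev L2Simplex (N n : ℕ) : Type := Lp ℂ 2 ((dτPow N n).restrict (simplex N n))

/-- The restriction map `L²(Δⁿ) → L²(Δ_n)`. -/
def restrictSimplex (N n : ℕ) : L2Pow N n →L[ℂ] L2Simplex N n :=
  LpToLpRestrictCLM (Fin n → Δ N) ℂ ℂ (dτPow N n) 2 (simplex N n)

open Classical in
/-- The extension by linearity and continuity of an assignment `x ↦ y`, `(x, y) ∈ S`, given on a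
set of elementary elements: the value at `x` is the `y` such that `(x, y)` lies in the closure of
the linear span of `S`. (Such a `y` exists for every `x`, and is unique, when the assignment
extends linearly to an isometry on a dense subspace, as for stochastic integrals.) -/
def closedExtension {E F : Type*} [NormedAddCommGroup E] [NormedSpace ℂ E]
    [NormedAddCommGroup F] [NormedSpace ℂ F] (S : Set (E × F)) (x : E) : F :=
  if h : ∃ y : F, (x, y) ∈ (Submodule.span ℂ S).topologicalClosure then h.choose else 0

section Integrals

variable {Ω : Type*} [MeasurableSpace Ω] {N : ℕ}

/-- Elementary Wiener integrals:
`∫_Δ 1_{(a, b] × {μ}} dW = W^μ_b - W^μ_a`. -/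
def elementaryWiener (W : Fin N → ℝ≥0 → Ω → ℝ) (P : Measure Ω) : Set (L2Δ N × Lp ℂ 2 P) :=
  {p | ∃ (a b : ℝ≥0) (μ : Fin N), a ≤ b ∧
    p.1 =ᵐ[dτ N] (Set.Ioc a b ×ˢ {μ}).indicator (fun _ => (1 : ℂ)) ∧
    p.2 =ᵐ[P] fun ω => ((W μ b ω - W μ a ω : ℝ) : ℂ)}

/-- The Wiener integral `W(h) = ∫_Δ h(τ) dW_τ`, for `h` in the complex space `L²(Δ)`
(complex linear in `h`). -/
def wienerIntegral (W : Fin N → ℝ≥0 → Ω → ℝ) (P : Measure Ω) (h : L2Δ N) : Lp ℂ 2 P :=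
  closedExtension (elementaryWiener W P) h

/-- Elementary iterated integrals: if `(a₁, b₁], …, (aₙ, bₙ]` are successive time intervals
(`bᵢ ≤ aⱼ` for `i < j`), so that `R = ∏ᵢ (aᵢ, bᵢ] × {μᵢ}` is contained in `Δ_n`, then
`∫_{Δ_n} 1_R dW ⋯ dW = ∏ᵢ (W^{μᵢ}_{bᵢ} - W^{μᵢ}_{aᵢ})`. -/
def elementaryIterated (W : Fin N → ℝ≥0 → Ω → ℝ) (P : Measure Ω) (n : ℕ) :
    Set (L2Simplex N n × Lp ℂ 2 P) :=
  {p | ∃ (a b : Fin n → ℝ≥0) (μ : Fin n → Fin N),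
    (∀ i, a i ≤ b i) ∧ (∀ i j, i < j → b i ≤ a j) ∧
    p.1 =ᵐ[(dτPow N n).restrict (simplex N n)]
      (Set.univ.pi fun i => Set.Ioc (a i) (b i) ×ˢ {μ i}).indicator (fun _ => (1 : ℂ)) ∧
    p.2 =ᵐ[P] fun ω => ∏ i, ((W (μ i) (b i) ω - W (μ i) (a i) ω : ℝ) : ℂ)}

/-- The iterated stochastic integral
`J_n(f) = ∫_{Δ_n} f(τ₁, …, τₙ) dW_{τ₁} ⋯ dW_{τₙ}` of a deterministic kernel `f ∈ L²(Δ_n)`. -/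
def iteratedIntegral (W : Fin N → ℝ≥0 → Ω → ℝ) (P : Measure Ω) (n : ℕ) (f : L2Simplex N n) :
    Lp ℂ 2 P :=
  closedExtension (elementaryIterated W P n) f

/-- The integrand `X exp(W(h) - ½ ∫_Δ h(τ)² dτ)`. -/
def generatingIntegrand (W : Fin N → ℝ≥0 → Ω → ℝ) (P : Measure Ω) (X : Lp ℂ 2 P) (h : L2Δ N)
    (ω : Ω) : ℂ :=
  X ω * Complex.exp (wienerIntegral W P h ω - (1 / 2) * ∫ τ, (h τ) ^ 2 ∂(dτ N))

/-- The generating functional `Z_X(h) = E[X exp(W(h) - ½ ∫_Δ h(τ)² dτ)]`. -/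
def generatingFunctional (W : Fin N → ℝ≥0 → Ω → ℝ) (P : Measure Ω) (X : Lp ℂ 2 P)
    (h : L2Δ N) : ℂ :=
  ∫ ω, generatingIntegrand W P X h ω ∂P

end Integrals

/-- `k` is the kernel of the `n`-th Fréchet derivative of `Z` at `0`:
`DⁿZ(0)[v₁, …, vₙ] = ∫_{Δⁿ} k(τ₁, …, τₙ) v₁(τ₁) ⋯ vₙ(τₙ) dτ₁ ⋯ dτₙ`. -/
def IsFrechetKernel {N : ℕ} (Z : L2Δ N → ℂ) (n : ℕ) (k : L2Pow N n) : Prop :=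
  ∀ v : Fin n → L2Δ N,
    iteratedFDeriv ℂ n Z 0 v = ∫ τ, k τ * ∏ i, v i (τ i) ∂(dτPow N n)

/-- The homogeneous term
`F⁽ⁿ⁾(h) = ∫_{Δ_n} f(τ₁, …, τₙ) h(τ₁) ⋯ h(τₙ) dτ₁ ⋯ dτₙ`. -/
def taylorTerm {N n : ℕ} (f : L2Simplex N n) (h : L2Δ N) : ℂ :=
  ∫ τ in simplex N n, f τ * ∏ i, h (τ i) ∂(dτPow N n)

end

end WienerChaos

/-! Two families of exponentials have the same Gram matrix. In the Fock space `⨁ₙ L²(Δ_n)` the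
exponential vector `e(h)` has components `h ⊗ ⋯ ⊗ h` on `Δ_n`. Since `Δⁿ` splits, up to a null set,
into `n!` reordered copies of `Δ_n`, one gets `⟨e(g), e(h)⟩ = ∑ ⟨g, h⟩ⁿ / n! = exp ⟨g, h⟩`
(`inner_expVec`). In `L²(P)` the renormalized exponentials `ℰ(h) = exp(W(h) - ½ ∫ h²)` satisfy
`⟨ℰ(g), ℰ(h)⟩ = exp ⟨g, h⟩` as well, by the Gaussian formula `E exp W(h) = exp(½ ∫ h²)` for complex
`h` (`integral_exp`, `inner_wickLp`). As the vectors `e(h)` are total, a linear isometry `V`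
(`chaos`) sends `e(h)` to `ℰ(h)`.

The range of `V` contains every square integrable `ℱ_∞`-measurable variable: a vector orthogonal to
all `ℰ(h)` has vanishing Fourier integrals against the Brownian path, hence vanishing integrals over
`ℱ_∞` (`inner_eq_zero_of_sigmaInfty`, `exists_chaos_eq`). So `X = V G`, and `Z_X(h) = ⟨ℰ(h̄), X⟩ =
⟨e(h̄), G⟩ = ∑ₙ ∫_{Δ_n} Gₙ h ⊗ ⋯ ⊗ h`. This power series has infinite radius of convergence, and the
kernel of its `n`-th derivative is the symmetric extension of `Gₙ` to `Δⁿ`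
(`iteratedFDeriv_inner_expVec`).

Finally `J_n` is `V` on the `n`-th summand. On ordered boxes this is checked by testing products of
increments against all `ℰ(h)` (`inner_wickLp_prod`, `chaos_single_orderedBoxLp`). The chaos
expansion of `X` is then the image under `V` of the orthogonal decomposition of `G`. -/

namespace WienerChaos

open Filter Topology Equiv
open scoped ComplexConjugate

/-! ### Isometries from Gram matrices, and extension by density -/

section HilbertSpace

variable {E F : Type*} [NormedAddCommGroup E] [InnerProductSpace ℂ E]
  [NormedAddCommGroup F] [InnerProductSpace ℂ F]

lemma inner_self_eq_ofReal (x : E) : inner ℂ x x = ((‖x‖ ^ 2 : ℝ) : ℂ) := by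
  rw [inner_self_eq_norm_sq_to_K]
  norm_cast

lemma inner_linearCombination_eq {ι : Type*} {e : ι → E} {y : ι → F}
    (h : ∀ i j, inner ℂ (y i) (y j) = inner ℂ (e i) (e j)) (c d : ι →₀ ℂ) :
    inner ℂ (Finsupp.linearCombination ℂ y c) (Finsupp.linearCombination ℂ y d) =
      inner ℂ (Finsupp.linearCombination ℂ e c) (Finsupp.linearCombination ℂ e d) := by
  simp only [Finsupp.linearCombination_apply, Finsupp.sum, sum_inner, inner_sum, inner_smul_left,
    inner_smul_right, h]

/-- Two families of vectors with the same Gram matrix, the first one total, are related by a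
linear isometry. -/
theorem exists_linearIsometry_of_inner_eq [CompleteSpace F] {ι : Type*} {e : ι → E} {y : ι → F}
    (h : ∀ i j, inner ℂ (y i) (y j) = inner ℂ (e i) (e j))
    (he : (Submodule.span ℂ (Set.range e)).topologicalClosure = ⊤) :
    ∃ U : E →ₗᵢ[ℂ] F, ∀ i, U (e i) = y i := by
  have hnorm : ∀ c, ‖Finsupp.linearCombination ℂ y c‖ = ‖Finsupp.linearCombination ℂ e c‖ := by
    intro c
    rw [@norm_eq_sqrt_re_inner ℂ, @norm_eq_sqrt_re_inner ℂ, inner_linearCombination_eq h]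
  have hdense : DenseRange (Finsupp.linearCombination ℂ e) := by
    rw [DenseRange, ← LinearMap.coe_range, Finsupp.range_linearCombination,
      Submodule.dense_iff_topologicalClosure_eq_top, he]
  -- Equality of norms makes the `y`-combination a function of the `e`-combination, so the map is
  -- well defined on a dense subspace and extends.
  have hb : ∃ C : ℝ, ∀ c, ‖Finsupp.linearCombination ℂ y c‖ ≤
      C * ‖Finsupp.linearCombination ℂ e c‖ := ⟨1, fun c => by simp [hnorm]⟩
  let U := (Finsupp.linearCombination ℂ y).extendOfNorm (Finsupp.linearCombination ℂ e)
  have hU : ∀ c, U (Finsupp.linearCombination ℂ e c) = Finsupp.linearCombination ℂ y c :=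
    LinearMap.extendOfNorm_eq hdense hb
  refine ⟨⟨U.toLinearMap, fun x => ?_⟩, fun i => ?_⟩
  · refine hdense.induction (P := fun x => ‖U x‖ = ‖x‖) ?_ (isClosed_eq (by fun_prop) (by fun_prop)) x
    rintro _ ⟨c, rfl⟩
    rw [hU, hnorm]
  · have := hU (Finsupp.single i 1)
    simpa using this

/-- The graph of `I` is a closed subspace containing `S`, so whatever value is chosen must be `I x`.
Density of the first components puts `(x, I x)` in the closed span, so the default value `0` is
never taken. -/
lemma closedExtension_eq (I : E →L[ℂ] F) {S : Set (E × F)} (hS : ∀ p ∈ S, p.2 = I p.1)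
    (hd : (Submodule.span ℂ (Prod.fst '' S)).topologicalClosure = ⊤) (x : E) :
    closedExtension S x = I x := by
  have hgraph : (Submodule.span ℂ S).topologicalClosure ≤ (I : E →ₗ[ℂ] F).graph := by
    refine Submodule.topologicalClosure_minimal _ (Submodule.span_le.2 fun p hp => ?_) ?_
    · exact (LinearMap.mem_graph_iff _ _).2 (hS p hp)
    · have : ((I : E →ₗ[ℂ] F).graph : Set (E × F)) = {p | p.2 = I p.1} := by
        ext p; simp [LinearMap.mem_graph_iff]
      rw [this]
      exact isClosed_eq (by fun_prop) (by fun_prop)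
  have hspan : ∀ z ∈ Submodule.span ℂ (Prod.fst '' S), (z, I z) ∈ Submodule.span ℂ S := by
    intro z hz
    induction hz using Submodule.span_induction with
    | mem z hz =>
      obtain ⟨p, hp, rfl⟩ := hz
      rw [← hS p hp]
      exact Submodule.subset_span hp
    | zero => rw [map_zero]; exact (Submodule.span ℂ S).zero_mem
    | add a b _ _ ha hb => simpa using add_mem ha hb
    | smul c a _ ha => simpa using Submodule.smul_mem _ c ha
  have hex : ∃ y : F, (x, y) ∈ (Submodule.span ℂ S).topologicalClosure := by
    refine ⟨I x, ?_⟩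
    have hx : x ∈ closure (Submodule.span ℂ (Prod.fst '' S) : Set E) := by
      rw [← Submodule.topologicalClosure_coe, hd]; trivial
    have hc : Continuous fun z : E => (z, I z) := by fun_prop
    exact map_mem_closure (f := fun z : E => (z, I z)) hc hx hspan
  rw [closedExtension, dif_pos hex]
  exact (LinearMap.mem_graph_iff _ _).1 (hgraph hex.choose_spec)

lemma span_closure_eq_top_of_orthogonal [CompleteSpace E] {s : Set E}
    (h : ∀ g, (∀ e ∈ s, inner ℂ e g = 0) → g = 0) :
    (Submodule.span ℂ s).topologicalClosure = ⊤ := by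
  rw [Submodule.topologicalClosure_eq_top_iff, Submodule.eq_bot_iff]
  exact fun g hg => h g fun e he => hg e (Submodule.subset_span he)

end HilbertSpace

/-! ### Vanishing of a function from integrals over a π-system -/

section SetIntegral

variable {α : Type*} [m0 : MeasurableSpace α] {ν : Measure α}

/-- The sets `A` with zero integral over `A ∩ B` form a λ-system; `hgB` handles complements.
Localizing to `B` allows functions that are not globally integrable. -/
lemma ae_eq_zero_of_setIntegral_inter_eq_zero {C : Set (Set α)} (hC : IsPiSystem C)
    (hgen : m0 = MeasurableSpace.generateFrom C) {B : Set α} (hB : MeasurableSet B) {g : α → ℂ}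
    (hg : IntegrableOn g B ν) (hgB : ∫ x in B, g x ∂ν = 0)
    (h : ∀ A ∈ C, ∫ x in A ∩ B, g x ∂ν = 0) : g =ᵐ[ν.restrict B] 0 := by
  have key : ∀ A, MeasurableSet A → ∫ x in A ∩ B, g x ∂ν = 0 := by
    intro A hA
    induction A, hA using MeasurableSpace.induction_on_inter hgen hC with
    | empty => simp
    | basic A hA => exact h A hA
    | compl A hA ih =>
      have := integral_inter_add_sdiff hA hg
      rw [Set.inter_comm, ih, zero_add, hgB] at this
      rwa [Set.inter_comm, ← Set.sdiff_eq]
    | iUnion f hd hm ih =>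
      rw [Set.iUnion_inter, integral_iUnion (fun i => (hm i).inter hB)
        (fun i j hij => (hd hij).mono Set.inter_subset_left Set.inter_subset_left)
        (hg.mono_set (Set.iUnion_subset fun i => Set.inter_subset_right))]
      simp [ih]
  refine Integrable.ae_eq_zero_of_forall_setIntegral_eq_zero hg fun A hA _ => ?_
  rw [Measure.restrict_restrict hA]
  exact key A hA

end SetIntegral

/-! ### Conjugation, real and imaginary parts, and the bilinear pairing on `L²` -/

section ConjugateLp

variable {α : Type*} [MeasurableSpace α] (ν : Measure α)

/-- Pointwise complex conjugation on `L²`. -/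
noncomputable def conjLp : Lp ℂ 2 ν →L[ℝ] Lp ℂ 2 ν := (Complex.conjCLE : ℂ →L[ℝ] ℂ).compLpL 2 ν

/-- The real part, as an element of the complex `L²` space. -/
noncomputable def reLp : Lp ℂ 2 ν →L[ℝ] Lp ℂ 2 ν :=
  (Complex.ofRealCLM.comp Complex.reCLM).compLpL 2 ν

/-- The imaginary part, as an element of the complex `L²` space. -/
noncomputable def imLp : Lp ℂ 2 ν →L[ℝ] Lp ℂ 2 ν :=
  (Complex.ofRealCLM.comp Complex.imCLM).compLpL 2 ν

variable {ν}

lemma coeFn_conjLp (h : Lp ℂ 2 ν) : conjLp ν h =ᵐ[ν] fun x => conj (h x) :=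
  ContinuousLinearMap.coeFn_compLpL _ h

lemma coeFn_reLp (h : Lp ℂ 2 ν) : reLp ν h =ᵐ[ν] fun x => ((h x).re : ℂ) :=
  ContinuousLinearMap.coeFn_compLpL _ h

lemma coeFn_imLp (h : Lp ℂ 2 ν) : imLp ν h =ᵐ[ν] fun x => ((h x).im : ℂ) :=
  ContinuousLinearMap.coeFn_compLpL _ h

lemma conjLp_conjLp (h : Lp ℂ 2 ν) : conjLp ν (conjLp ν h) = h := by
  ext1
  filter_upwards [coeFn_conjLp h, coeFn_conjLp (conjLp ν h)] with x h1 h2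
  rw [h2, h1, Complex.conj_conj]

lemma conjLp_smul (c : ℂ) (h : Lp ℂ 2 ν) : conjLp ν (c • h) = conj c • conjLp ν h := by
  ext1
  filter_upwards [coeFn_conjLp h, coeFn_conjLp (c • h), Lp.coeFn_smul c h,
    Lp.coeFn_smul (conj c) (conjLp ν h)] with x h1 h2 h3 h4
  rw [h2, h3, h4, Pi.smul_apply, Pi.smul_apply, h1]
  simp

lemma reLp_add_imLp (h : Lp ℂ 2 ν) : reLp ν h + Complex.I • imLp ν h = h := by
  ext1
  filter_upwards [coeFn_reLp h, coeFn_imLp h, Lp.coeFn_add (reLp ν h) (Complex.I • imLp ν h),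
    Lp.coeFn_smul Complex.I (imLp ν h)] with x h1 h2 h3 h4
  rw [h3, Pi.add_apply, h4, Pi.smul_apply, h1, h2, smul_eq_mul, mul_comm, Complex.re_add_im]

lemma conjLp_reLp (h : Lp ℂ 2 ν) : conjLp ν (reLp ν h) = reLp ν h := by
  ext1
  filter_upwards [coeFn_reLp h, coeFn_conjLp (reLp ν h)] with x h1 h2
  rw [h2, h1, Complex.conj_ofReal]

lemma conjLp_imLp (h : Lp ℂ 2 ν) : conjLp ν (imLp ν h) = imLp ν h := by
  ext1
  filter_upwards [coeFn_imLp h, coeFn_conjLp (imLp ν h)] with x h1 h2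
  rw [h2, h1, Complex.conj_ofReal]

lemma reLp_eq_self {h : Lp ℂ 2 ν} (hh : conjLp ν h = h) : reLp ν h = h := by
  ext1
  have := coeFn_conjLp h
  rw [hh] at this
  filter_upwards [coeFn_reLp h, this] with x h1 h2
  rw [h1]
  exact Complex.conj_eq_iff_re.1 h2.symm

/-- The bilinear pairing `∫ g h`. -/
noncomputable def pairing (g h : Lp ℂ 2 ν) : ℂ := inner ℂ (conjLp ν g) h

lemma pairing_eq_integral (g h : Lp ℂ 2 ν) : pairing g h = ∫ x, g x * h x ∂ν := by
  rw [pairing, L2.inner_def]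
  refine integral_congr_ae ?_
  filter_upwards [coeFn_conjLp g] with x hx
  simp [hx, mul_comm]

lemma pairing_comm (g h : Lp ℂ 2 ν) : pairing g h = pairing h g := by
  simp only [pairing_eq_integral, mul_comm]

lemma pairing_add_left (g g' h : Lp ℂ 2 ν) : pairing (g + g') h = pairing g h + pairing g' h := by
  simp [pairing, inner_add_left]

lemma pairing_add_right (g h h' : Lp ℂ 2 ν) : pairing g (h + h') = pairing g h + pairing g h' := by
  simp [pairing, inner_add_right]

lemma pairing_smul_left (c : ℂ) (g h : Lp ℂ 2 ν) : pairing (c • g) h = c * pairing g h := by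
  simp [pairing, conjLp_smul, inner_smul_left]

lemma pairing_smul_right (c : ℂ) (g h : Lp ℂ 2 ν) : pairing g (c • h) = c * pairing g h := by
  simp [pairing, inner_smul_right]

lemma inner_eq_pairing (g h : Lp ℂ 2 ν) : inner ℂ g h = pairing (conjLp ν g) h := by
  rw [pairing, conjLp_conjLp]

lemma pairing_self_of_real {h : Lp ℂ 2 ν} (hh : conjLp ν h = h) :
    pairing h h = ((‖h‖ ^ 2 : ℝ) : ℂ) := by
  rw [pairing, hh, inner_self_eq_ofReal]

lemma conj_pairing (g h : Lp ℂ 2 ν) :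
    conj (pairing g h) = pairing (conjLp ν g) (conjLp ν h) := by
  rw [pairing, inner_conj_symm, inner_eq_pairing, pairing_comm]

end ConjugateLp

/-! ### The measure on `Δⁿ`, null sets of coinciding times, and determining boxes -/

section BaseSpace

variable {N : ℕ}

lemma measurableEmbedding_nnreal_coe : MeasurableEmbedding ((↑) : ℝ≥0 → ℝ) :=
  MeasurableEmbedding.subtype_coe measurableSet_Ici

lemma nnreal_volume_apply (s : Set ℝ≥0) :
    Measure.comap ((↑) : ℝ≥0 → ℝ) volume s = volume (((↑) : ℝ≥0 → ℝ) '' s) :=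
  measurableEmbedding_nnreal_coe.comap_apply _ _

lemma nnreal_volume_Ioc (a b : ℝ≥0) :
    Measure.comap ((↑) : ℝ≥0 → ℝ) volume (Set.Ioc a b) = ENNReal.ofReal (b - a : ℝ) := by
  rw [nnreal_volume_apply, NNReal.image_coe_Ioc, Real.volume_Ioc]

lemma nnreal_volume_singleton (a : ℝ≥0) :
    Measure.comap ((↑) : ℝ≥0 → ℝ) volume {a} = 0 := by
  rw [nnreal_volume_apply, Set.image_singleton, Real.volume_singleton]

instance sigmaFinite_nnreal_volume :
    SigmaFinite (Measure.comap ((↑) : ℝ≥0 → ℝ) volume) := by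
  refine ⟨⟨⟨fun n => Set.Iic (n : ℝ≥0), fun _ => trivial, fun n => ?_, ?_⟩⟩⟩
  · have : (Set.Iic (n : ℝ≥0)) ⊆ {0} ∪ Set.Ioc 0 (n : ℝ≥0) := by
      intro x hx
      rcases eq_or_ne x 0 with h | h
      · exact Or.inl h
      · exact Or.inr ⟨pos_iff_ne_zero.2 h, hx⟩
    refine lt_of_le_of_lt ((measure_mono this).trans (measure_union_le _ _)) ?_
    rw [nnreal_volume_singleton, nnreal_volume_Ioc, zero_add]
    exact ENNReal.ofReal_lt_top
  · exact Set.iUnion_eq_univ_iff.2 fun x => exists_nat_ge x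

instance sigmaFinite_dτ : SigmaFinite (dτ N) := by unfold dτ; infer_instance

lemma dτ_Ioc (a b : ℝ≥0) (μ : Fin N) :
    dτ N (Set.Ioc a b ×ˢ {μ}) = ENNReal.ofReal (b - a : ℝ) := by
  rw [dτ, Measure.prod_prod, nnreal_volume_Ioc]
  simp

lemma dτ_time_eq (s : ℝ≥0) : dτ N {x | x.1 = s} = 0 := by
  have : {x : Δ N | x.1 = s} = {s} ×ˢ Set.univ := by ext; simp
  rw [this, dτ, Measure.prod_prod, nnreal_volume_singleton, zero_mul]

lemma dτPow_time_eq {n : ℕ} (i : Fin n) (s : ℝ≥0) : dτPow N n {τ | (τ i).1 = s} = 0 :=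
  (Measure.quasiMeasurePreserving_eval (fun _ : Fin n => dτ N) i).preimage_null (dτ_time_eq s)

/-- By Fubini, after splitting off coordinate `i`: each slice prescribes the time of another
coordinate, which is a null condition. -/
lemma dτPow_tie {n : ℕ} {i j : Fin n} (hij : i ≠ j) :
    dτPow N n {τ | (τ i).1 = (τ j).1} = 0 := by
  cases n with
  | zero => exact i.elim0
  | succ n =>
    obtain ⟨k, rfl⟩ := Fin.exists_succAbove_eq hij.symm
    have hmp := measurePreserving_piFinSuccAbove (fun _ : Fin (n + 1) => dτ N) i
    have hmeas : MeasurableSet {p : Δ N × (Fin n → Δ N) | p.1.1 = (p.2 k).1} :=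
      measurableSet_eq_fun (by fun_prop) (by fun_prop)
    have hnull : ((dτ N).prod (Measure.pi fun _ : Fin n => dτ N))
        {p : Δ N × (Fin n → Δ N) | p.1.1 = (p.2 k).1} = 0 := by
      rw [Measure.measure_prod_null hmeas]
      refine Eventually.of_forall fun x => ?_
      have : Prod.mk x ⁻¹' {p : Δ N × (Fin n → Δ N) | p.1.1 = (p.2 k).1} =
          {τ | (τ k).1 = x.1} := by ext; simp [eq_comm]
      change (dτPow N n) (Prod.mk x ⁻¹' _) = 0
      rw [this]
      exact dτPow_time_eq k x.1
    have := hmp.measure_preimage hmeas.nullMeasurableSet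
    rw [hnull] at this
    exact this

lemma ae_times_injective (n : ℕ) :
    ∀ᵐ τ ∂(dτPow N n), Function.Injective fun i => (τ i).1 := by
  have : ∀ᵐ τ ∂(dτPow N n), ∀ i j, i ≠ j → (τ i).1 ≠ (τ j).1 := by
    simp only [ae_all_iff]
    intro i j hij
    exact measure_eq_zero_iff_ae_notMem.1 (dτPow_tie hij)
  filter_upwards [this] with τ hτ i j h
  by_contra hij
  exact hτ i j hij h

lemma ae_times_pos (n : ℕ) : ∀ᵐ τ ∂(dτPow N n), ∀ i, 0 < (τ i).1 := by
  rw [ae_all_iff]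
  intro i
  filter_upwards [measure_eq_zero_iff_ae_notMem.1 (dτPow_time_eq (N := N) i 0)] with τ hτ
  exact pos_iff_ne_zero.2 hτ

lemma measurableSet_simplex (n : ℕ) : MeasurableSet (simplex N n) := by
  have : simplex N n = ⋂ (i : Fin n) (j : Fin n) (_ : i ≤ j), {τ | (τ i).1 ≤ (τ j).1} := by
    ext τ; simp [simplex, Monotone]
  rw [this]
  refine MeasurableSet.iInter fun i => MeasurableSet.iInter fun j => MeasurableSet.iInter fun _ => ?_
  exact measurableSet_le (by fun_prop) (by fun_prop)

/-- The box `∏ᵢ (aᵢ, bᵢ] × {μᵢ}`. -/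
def box {n : ℕ} (a b : Fin n → ℝ≥0) (μ : Fin n → Fin N) : Set (Fin n → Δ N) :=
  Set.univ.pi fun i => Set.Ioc (a i) (b i) ×ˢ {μ i}

lemma measurableSet_box {n : ℕ} (a b : Fin n → ℝ≥0) (μ : Fin n → Fin N) :
    MeasurableSet (box a b μ) :=
  MeasurableSet.univ_pi fun _ => measurableSet_Ioc.prod (measurableSet_singleton _)

lemma mem_box {n : ℕ} {a b : Fin n → ℝ≥0} {μ : Fin n → Fin N} {τ : Fin n → Δ N} :
    τ ∈ box a b μ ↔ ∀ i, (a i < (τ i).1 ∧ (τ i).1 ≤ b i) ∧ (τ i).2 = μ i := by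
  simp [box, Set.mem_pi]

lemma dτPow_box_lt_top {n : ℕ} (a b : Fin n → ℝ≥0) (μ : Fin n → Fin N) :
    dτPow N n (box a b μ) < ∞ := by
  rw [box, dτPow, Measure.pi_pi]
  exact ENNReal.prod_lt_top fun i _ => by rw [dτ_Ioc]; exact ENNReal.ofReal_lt_top

lemma box_subset_simplex {n : ℕ} {a b : Fin n → ℝ≥0} (hab : ∀ i j, i < j → b i ≤ a j)
    (μ : Fin n → Fin N) : box a b μ ⊆ simplex N n := by
  intro τ hτ i j hij
  rw [mem_box] at hτ
  rcases hij.eq_or_lt with rfl | h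
  · exact le_rfl
  · exact ((hτ i).1.2.trans (hab i j h)).trans (hτ j).1.1.le

/-- The π-system of half-lines times arbitrary sets of components. -/
def halfLines (N : ℕ) : Set (Set (Δ N)) :=
  Set.image2 (fun x1 x2 => x1 ×ˢ x2) (Set.range Set.Iic) {s : Set (Fin N) | MeasurableSet s}

lemma isPiSystem_halfLines : IsPiSystem (halfLines N) :=
  isPiSystem_Iic.prod MeasurableSpace.isPiSystem_measurableSet

lemma isCountablySpanning_range_Iic : IsCountablySpanning (Set.range (Set.Iic : ℝ≥0 → Set ℝ≥0)) :=
  ⟨fun n => Set.Iic (n : ℝ≥0), fun n => ⟨n, rfl⟩,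
    Set.iUnion_eq_univ_iff.2 fun x => exists_nat_ge x⟩

lemma generateFrom_halfLines :
    MeasurableSpace.generateFrom (halfLines N) = Prod.instMeasurableSpace := by
  refine generateFrom_eq_prod ?_ MeasurableSpace.generateFrom_measurableSet
    isCountablySpanning_range_Iic isCountablySpanning_measurableSet
  rw [← borel_eq_generateFrom_Iic]
  exact (BorelSpace.measurable_eq (α := ℝ≥0)).symm

lemma isCountablySpanning_halfLines : IsCountablySpanning (halfLines N) :=
  isCountablySpanning_range_Iic.prod isCountablySpanning_measurableSet

/-- Cutting an interval by a half-line keeps its left end, so integrals over intervals already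
control the whole π-system. -/
lemma halfLine_inter_Ioc {A : Set (Δ N)} (hA : A ∈ halfLines N) (a b : ℝ≥0) (μ : Fin N) :
    A ∩ (Set.Ioc a b ×ˢ {μ}) = ∅ ∨
      ∃ c, a ≤ c ∧ c ≤ b ∧ A ∩ (Set.Ioc a b ×ˢ {μ}) = Set.Ioc a c ×ˢ {μ} := by
  obtain ⟨_, ⟨c, rfl⟩, S, -, rfl⟩ := hA
  by_cases hμ : μ ∈ S
  · rcases le_total a (min b c) with h | h
    · right
      refine ⟨min b c, h, min_le_left _ _, ?_⟩
      ext ⟨s, ν⟩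
      simp only [Set.mem_inter_iff, Set.mem_prod, Set.mem_Iic, Set.mem_Ioc,
        Set.mem_singleton_iff, le_min_iff]
      constructor
      · rintro ⟨⟨h1, -⟩, h2, h3⟩; exact ⟨⟨h2.1, h2.2, h1⟩, h3⟩
      · rintro ⟨⟨h1, h2, h3⟩, rfl⟩; exact ⟨⟨h3, hμ⟩, ⟨h1, h2⟩, rfl⟩
    · left
      ext ⟨s, ν⟩
      simp only [Set.mem_inter_iff, Set.mem_prod, Set.mem_Iic, Set.mem_Ioc,
        Set.mem_singleton_iff, Set.mem_empty_iff_false, iff_false]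
      rintro ⟨⟨h1, -⟩, ⟨h2, h3⟩, -⟩
      exact absurd (lt_of_lt_of_le h2 (le_min h3 h1)) (not_lt.2 h)
  · left
    ext ⟨s, ν⟩
    simp only [Set.mem_inter_iff, Set.mem_prod, Set.mem_singleton_iff, Set.mem_empty_iff_false,
      iff_false]
    rintro ⟨⟨-, h1⟩, -, rfl⟩
    exact hμ h1

lemma integrableOn_of_memLp {α : Type*} [MeasurableSpace α] {ν : Measure α} {g : α → ℂ}
    {B : Set α} (hg : MemLp g 2 (ν.restrict B)) (hB : ν B < ∞) : IntegrableOn g B ν := by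
  have : IsFiniteMeasure (ν.restrict B) := ⟨by simpa using hB⟩
  exact hg.integrable (by norm_num)

/-- A square integrable function on `Δ` is determined by its integrals over intervals. -/
lemma ae_eq_zero_of_integral_Ioc_eq_zero {g : Δ N → ℂ} (hg : MemLp g 2 (dτ N))
    (h : ∀ a b μ, a ≤ b → ∫ x in Set.Ioc a b ×ˢ {μ}, g x ∂(dτ N) = 0) : g =ᵐ[dτ N] 0 := by
  have hB : ∀ (k : ℕ) (μ : Fin N), ∀ᵐ x ∂(dτ N), x ∈ Set.Ioc (0 : ℝ≥0) k ×ˢ {μ} → g x = 0 := by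
    intro k μ
    have hm : MeasurableSet (Set.Ioc (0 : ℝ≥0) (k : ℝ≥0) ×ˢ {μ}) :=
      measurableSet_Ioc.prod (measurableSet_singleton _)
    rw [← ae_restrict_iff' hm]
    refine ae_eq_zero_of_setIntegral_inter_eq_zero isPiSystem_halfLines
      generateFrom_halfLines.symm hm
      (integrableOn_of_memLp (hg.restrict _) (by rw [dτ_Ioc]; exact ENNReal.ofReal_lt_top))
      (h _ _ _ zero_le) fun A hA => ?_
    rcases halfLine_inter_Ioc hA 0 (k : ℝ≥0) μ with h0 | ⟨c, hc, -, h1⟩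
    · rw [h0]; simp
    · rw [h1]; exact h _ _ _ hc
  have hall : ∀ᵐ x ∂(dτ N), ∀ (k : ℕ) (μ : Fin N), x ∈ Set.Ioc (0 : ℝ≥0) k ×ˢ {μ} → g x = 0 := by
    simp only [ae_all_iff]; exact hB
  filter_upwards [hall, measure_eq_zero_iff_ae_notMem.1 (dτ_time_eq (N := N) 0)] with x hx hx0
  obtain ⟨k, hk⟩ := exists_nat_ge x.1
  exact hx k x.2 ⟨⟨pos_iff_ne_zero.2 hx0, hk⟩, rfl⟩

/-- Only sub-boxes with the same lower corner are needed. When the large box has successive time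
intervals, these sub-boxes have them too, which makes the lemma usable inside the ordered region. -/
lemma ae_eq_zero_on_box {n : ℕ} {g : (Fin n → Δ N) → ℂ} {a b : Fin n → ℝ≥0}
    {μ : Fin n → Fin N} (hg : IntegrableOn g (box a b μ) (dτPow N n)) (hab : a ≤ b)
    (h : ∀ c, a ≤ c → c ≤ b → ∫ τ in box a c μ, g τ ∂(dτPow N n) = 0) :
    ∀ᵐ τ ∂(dτPow N n), τ ∈ box a b μ → g τ = 0 := by
  rw [← ae_restrict_iff' (measurableSet_box a b μ)]
  refine ae_eq_zero_of_setIntegral_inter_eq_zero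
    (C := Set.univ.pi '' Set.univ.pi fun _ : Fin n => halfLines N)
    (IsPiSystem.pi fun _ => isPiSystem_halfLines) ?_ (measurableSet_box a b μ) hg (h b hab le_rfl) ?_
  · exact (generateFrom_eq_pi (fun _ => generateFrom_halfLines)
      fun _ => isCountablySpanning_halfLines).symm
  · rintro _ ⟨A, hA, rfl⟩
    have hA' : ∀ i, A i ∈ halfLines N := fun i => hA i trivial
    rw [box, ← Set.pi_inter_distrib]
    by_cases hne : ∃ i, A i ∩ (Set.Ioc (a i) (b i) ×ˢ {μ i}) = ∅
    · obtain ⟨i, hi⟩ := hne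
      rw [Set.univ_pi_eq_empty (i := i) (by exact hi)]
      simp
    · push Not at hne
      choose c hc1 hc2 hc3 using fun i => (halfLine_inter_Ioc (hA' i) (a i) (b i) (μ i)).resolve_left
        (hne i).ne_empty
      simp_rw [hc3]
      exact h c hc1 hc2

/-- A square integrable function on `Δⁿ` is determined by its integrals over boxes. -/
lemma ae_eq_zero_of_integral_box_eq_zero {n : ℕ} {g : (Fin n → Δ N) → ℂ}
    (hg : MemLp g 2 (dτPow N n))
    (h : ∀ a b μ, a ≤ b → ∫ τ in box a b μ, g τ ∂(dτPow N n) = 0) : g =ᵐ[dτPow N n] 0 := by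
  have hall : ∀ᵐ τ ∂(dτPow N n), ∀ (k : ℕ) (μ : Fin n → Fin N),
      τ ∈ box (fun _ => 0) (fun _ => (k : ℝ≥0)) μ → g τ = 0 := by
    simp only [ae_all_iff]
    intro k μ
    exact ae_eq_zero_on_box (integrableOn_of_memLp (hg.restrict _) (dτPow_box_lt_top _ _ _))
      (fun _ => zero_le) fun c hc _ => h _ _ _ hc
  filter_upwards [hall, ae_times_pos n] with τ hτ hpos
  obtain ⟨k, hk⟩ : ∃ k : ℕ, ∀ i, (τ i).1 ≤ k := by
    obtain ⟨k, hk⟩ := exists_nat_ge (Finset.univ.sup fun i => (τ i).1)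
    exact ⟨k, fun i => (Finset.le_sup (f := fun i => (τ i).1) (Finset.mem_univ i)).trans hk⟩
  exact hτ k (fun i => (τ i).2) (mem_box.2 fun i => ⟨⟨hpos i, hk i⟩, rfl⟩)

/-- A square integrable function on the ordered region is determined by its integrals over the
ordered boxes. -/
lemma ae_eq_zero_of_integral_ordered_box_eq_zero {n : ℕ} {g : (Fin n → Δ N) → ℂ}
    (hg : MemLp g 2 ((dτPow N n).restrict (simplex N n)))
    (h : ∀ a b μ, (∀ i, a i ≤ b i) → (∀ i j, i < j → b i ≤ a j) →
      ∫ τ in box a b μ, g τ ∂(dτPow N n) = 0) :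
    g =ᵐ[(dτPow N n).restrict (simplex N n)] 0 := by
  -- Countably many grid boxes of mesh `1 / (k + 1)` whose cell indices `m` strictly increase. They
  -- are ordered boxes, and over all `k` they cover almost all of the ordered region.
  have hall : ∀ᵐ τ ∂(dτPow N n), ∀ (k : ℕ) (m : Fin n → ℕ) (μ : Fin n → Fin N),
      (∀ i j, i < j → m i + 1 ≤ m j) →
      τ ∈ box (fun i => (m i / (k + 1) : ℝ≥0)) (fun i => ((m i + 1) / (k + 1) : ℝ≥0)) μ →
      g τ = 0 := by
    simp only [ae_all_iff]
    intro k m μ hm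
    have hm' : ∀ i j, i < j → ((m i + 1) / (k + 1) : ℝ≥0) ≤ (m j / (k + 1) : ℝ≥0) := by
      intro i j hij
      gcongr
      exact_mod_cast hm i j hij
    have hsub := box_subset_simplex hm' μ
    refine ae_eq_zero_on_box (integrableOn_of_memLp (hg.mono_measure
      (Measure.restrict_mono hsub le_rfl)) (dτPow_box_lt_top _ _ _))
      (fun i => by dsimp only; gcongr; exact le_self_add) fun c hc1 hc2 => h _ _ _ hc1 ?_
    exact fun i j hij => (hc2 i).trans (hm' i j hij)
  rw [EventuallyEq, ae_restrict_iff' (measurableSet_simplex n)]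
  filter_upwards [hall, ae_times_pos n, ae_times_injective n] with τ hτ hpos hinj hmono
  have hstrict : StrictMono fun i => (τ i).1 := Monotone.strictMono_of_injective hmono hinj
  -- A mesh no larger than the smallest gap between the distinct times puts these times in different
  -- cells.
  obtain ⟨k, hk⟩ : ∃ k : ℕ, ∀ i j, i < j → 1 ≤ (k + 1 : ℝ) * ((τ j).1 - (τ i).1 : ℝ) := by
    have : ∀ᶠ k : ℕ in atTop, ∀ i j, i < j → 1 ≤ (k + 1 : ℝ) * ((τ j).1 - (τ i).1 : ℝ) := by
      rw [eventually_all]; intro i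
      rw [eventually_all]; intro j
      by_cases hij : i < j
      · have hpos' : (0 : ℝ) < (τ j).1 - (τ i).1 := sub_pos.2 (hstrict hij)
        have h1 : Tendsto (fun k : ℕ => (k + 1 : ℝ) * ((τ j).1 - (τ i).1 : ℝ)) atTop atTop :=
          (tendsto_natCast_atTop_atTop.atTop_add tendsto_const_nhds).atTop_mul_const hpos'
        filter_upwards [h1.eventually_ge_atTop 1] with k hk _ using hk
      · exact Eventually.of_forall fun k h => absurd h hij
    exact this.exists
  have hc : ∀ i, 1 ≤ ⌈((k + 1) * (τ i).1 : ℝ≥0)⌉₊ := fun i =>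
    Nat.one_le_ceil_iff.2 (mul_pos (by positivity) (hpos i))
  have hcR : ∀ i, (((⌈((k + 1) * (τ i).1 : ℝ≥0)⌉₊ - 1 : ℕ) : ℝ≥0) + 1) =
      ⌈((k + 1) * (τ i).1 : ℝ≥0)⌉₊ := by
    intro i
    have := Nat.sub_add_cancel (hc i)
    exact_mod_cast this
  -- Cells are open on the left and closed on the right, so the cell index is the ceiling minus one;
  -- the times being positive, this subtraction does not truncate.
  refine hτ k (fun i => ⌈((k + 1) * (τ i).1 : ℝ≥0)⌉₊ - 1) (fun i => (τ i).2) ?_ ?_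
  · intro i j hij
    have h1 : ((k + 1) * (τ i).1 + 1 : ℝ≥0) ≤ (k + 1) * (τ j).1 := by
      rw [← NNReal.coe_le_coe]
      push_cast
      linarith [hk i j hij]
    have h2 : (⌈((k + 1) * (τ i).1 : ℝ≥0)⌉₊ : ℝ≥0) < ⌈((k + 1) * (τ j).1 : ℝ≥0)⌉₊ :=
      calc (⌈((k + 1) * (τ i).1 : ℝ≥0)⌉₊ : ℝ≥0) < (k + 1) * (τ i).1 + 1 :=
            Nat.ceil_lt_add_one zero_le
        _ ≤ (k + 1) * (τ j).1 := h1
        _ ≤ _ := Nat.le_ceil _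
    have h3 : ⌈((k + 1) * (τ i).1 : ℝ≥0)⌉₊ < ⌈((k + 1) * (τ j).1 : ℝ≥0)⌉₊ := by exact_mod_cast h2
    have := hc i
    omega
  · refine mem_box.2 fun i => ⟨⟨?_, ?_⟩, rfl⟩
    · rw [div_lt_iff₀ (by positivity), mul_comm (τ i).1]
      have := Nat.ceil_lt_add_one ((zero_le : 0 ≤ ((k + 1) * (τ i).1 : ℝ≥0)))
      rw [← hcR i] at this
      exact lt_of_add_lt_add_right this
    · rw [le_div_iff₀ (by positivity), mul_comm (τ i).1, hcR i]
      exact Nat.le_ceil _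

end BaseSpace

/-! ### Orderings of `Δⁿ` and symmetric extension from the ordered region -/

section Symmetrization

variable {N n : ℕ}

lemma measurePreserving_comp_perm (σ : Perm (Fin n)) :
    MeasurePreserving (fun τ : Fin n → Δ N => τ ∘ σ) (dτPow N n) (dτPow N n) := by
  have := measurePreserving_piCongrLeft (fun _ : Fin n => dτ N) σ⁻¹
  convert this using 1
  swap
  · rfl
  swap
  · rfl
  ext1 τ
  ext1 i
  have := MeasurableEquiv.piCongrLeft_apply_apply (β := fun _ : Fin n => Δ N) σ⁻¹ τ (σ i)
  simpa using this.symm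

lemma measurableEmbedding_comp_perm (σ : Perm (Fin n)) :
    MeasurableEmbedding (fun τ : Fin n → Δ N => τ ∘ σ) := by
  have h : ∀ ρ : Perm (Fin n), Measurable (fun τ : Fin n → Δ N => τ ∘ ρ) := fun ρ =>
    measurable_pi_lambda _ fun i => measurable_pi_apply _
  refine MeasurableEquiv.measurableEmbedding
    (⟨⟨fun τ => τ ∘ σ, fun τ => τ ∘ (σ⁻¹ : Perm (Fin n)), ?_, ?_⟩, h _, h _⟩ : (Fin n → Δ N) ≃ᵐ (Fin n → Δ N))
  · intro τ; ext1 i; simp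
  · intro τ; ext1 i; simp

/-- Sorting the times gives the permutation; distinct times leave no other choice. -/
lemma existsUnique_perm_mem_simplex {τ : Fin n → Δ N}
    (hτ : Function.Injective fun i => (τ i).1) : ∃! σ : Perm (Fin n), τ ∘ σ ∈ simplex N n := by
  refine ⟨Tuple.sort fun i => (τ i).1, Tuple.monotone_sort fun i => (τ i).1, fun σ hσ => ?_⟩
  have h := Tuple.unique_monotone (f := fun i => (τ i).1) (σ := σ)
    (τ := Tuple.sort fun i => (τ i).1) hσ (Tuple.monotone_sort _)
  ext1 i
  exact hτ (congrFun h i)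

open Classical in
lemma sum_indicator_comp_perm {E : Type*} [AddCommMonoid E] {τ : Fin n → Δ N}
    (hτ : Function.Injective fun i => (τ i).1) (c : E) :
    ∑ σ : Perm (Fin n), (if τ ∘ σ ∈ simplex N n then c else 0) = c := by
  obtain ⟨σ, hσ, huniq⟩ := existsUnique_perm_mem_simplex hτ
  rw [Finset.sum_eq_single σ]
  · rw [if_pos hσ]
  · intro ρ _ hρ
    rw [if_neg fun h => hρ (huniq ρ h)]
  · simp

/-- An integral over `Δⁿ` is the sum over all orderings of integrals over the ordered region. -/
lemma integral_eq_sum_setIntegral_simplex {F : (Fin n → Δ N) → ℂ}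
    (hF : Integrable F (dτPow N n)) :
    ∫ τ, F τ ∂(dτPow N n) = ∑ σ : Perm (Fin n), ∫ τ in simplex N n, F (τ ∘ σ) ∂(dτPow N n) := by
  classical
  have hS := measurableSet_simplex (N := N) n
  have h1 : ∫ τ, F τ ∂(dτPow N n) =
      ∫ τ, ∑ σ : Perm (Fin n), (if τ ∘ σ ∈ simplex N n then F τ else 0) ∂(dτPow N n) := by
    refine integral_congr_ae ?_
    filter_upwards [ae_times_injective n] with τ hτ
    exact (sum_indicator_comp_perm hτ _).symm
  rw [h1, integral_finsetSum]
  -- Summing over inverses lets the substitution `τ ↦ τ ∘ σ` move the condition `τ ∘ σ⁻¹ ∈ Δ_n` back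
  -- to `τ ∈ Δ_n`.
  · rw [← Equiv.sum_comp (Equiv.inv (Perm (Fin n)))]
    refine Finset.sum_congr rfl fun σ _ => ?_
    rw [← integral_indicator hS, ← (measurePreserving_comp_perm (N := N) σ).integral_comp
      (measurableEmbedding_comp_perm σ)]
    refine integral_congr_ae (Eventually.of_forall fun τ => ?_)
    have : (τ ∘ σ) ∘ (σ⁻¹ : Perm (Fin n)) = τ := by ext1 i; simp
    simp only [Equiv.inv_apply, this, Set.indicator]
  · intro σ _
    exact (hF.indicator ((measurePreserving_comp_perm (N := N) σ).measurable hS)).congr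
      (Eventually.of_forall fun τ => by simp [Set.indicator])

/-- The values of the symmetric extension to `Δⁿ` of a function on the ordered region. -/
noncomputable def symExtFun (G : (Fin n → Δ N) → ℂ) (τ : Fin n → Δ N) : ℂ :=
  ∑ σ : Perm (Fin n), (simplex N n).indicator G (τ ∘ σ)

lemma symExtFun_comp_perm (G : (Fin n → Δ N) → ℂ) (τ : Fin n → Δ N) (ρ : Perm (Fin n)) :
    symExtFun G (τ ∘ ρ) = symExtFun G τ := by
  rw [symExtFun, symExtFun, ← Equiv.sum_comp (Equiv.mulLeft ρ)
    (fun σ => (simplex N n).indicator G (τ ∘ σ))]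
  rfl

lemma symExtFun_of_mem_simplex (G : (Fin n → Δ N) → ℂ) {τ : Fin n → Δ N}
    (hτ : Function.Injective fun i => (τ i).1) (hS : τ ∈ simplex N n) : symExtFun G τ = G τ := by
  have huniq := fun σ => (existsUnique_perm_mem_simplex hτ).unique (y₁ := σ) (y₂ := 1)
  rw [symExtFun, Finset.sum_eq_single 1]
  · exact Set.indicator_of_mem hS G
  · intro σ _ hσ
    exact Set.indicator_of_notMem (fun h => hσ (huniq σ h hS)) G
  · simp

lemma memLp_symExtFun (G : L2Simplex N n) : MemLp (symExtFun G) 2 (dτPow N n) := by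
  unfold symExtFun
  refine memLp_finsetSum _ fun σ _ => ?_
  have : MemLp ((simplex N n).indicator G) 2 (dτPow N n) :=
    (memLp_indicator_iff_restrict (measurableSet_simplex n)).2 (Lp.memLp G)
  exact this.comp_measurePreserving (measurePreserving_comp_perm σ)

/-- The symmetric extension to `Δⁿ` of a kernel on the ordered region. -/
noncomputable def symExt (G : L2Simplex N n) : L2Pow N n := (memLp_symExtFun G).toLp

lemma coeFn_symExt (G : L2Simplex N n) : symExt G =ᵐ[dτPow N n] symExtFun G :=
  MemLp.coeFn_toLp _

lemma ae_simplex_injective :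
    ∀ᵐ τ ∂((dτPow N n).restrict (simplex N n)),
      τ ∈ simplex N n ∧ Function.Injective fun i => (τ i).1 :=
  (ae_restrict_mem (measurableSet_simplex n)).and (ae_restrict_of_ae (ae_times_injective n))

lemma restrictSimplex_symExt (G : L2Simplex N n) : restrictSimplex N n (symExt G) = G := by
  ext1
  filter_upwards [LpToLpRestrictCLM_coeFn ℂ (simplex N n) (symExt G),
    ae_restrict_of_ae (coeFn_symExt G), ae_simplex_injective] with τ h1 h2 h3
  rw [restrictSimplex, h1, h2, symExtFun_of_mem_simplex _ h3.2 h3.1]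

lemma integrable_mul_of_memLp {α : Type*} [MeasurableSpace α] {ν : Measure α} {f g : α → ℂ}
    (hf : MemLp f 2 ν) (hg : MemLp g 2 ν) : Integrable (fun x => f x * g x) ν :=
  hf.integrable_mul hg

lemma integral_symExt_mul {G : L2Simplex N n} {f : (Fin n → Δ N) → ℂ}
    (hf : MemLp f 2 (dτPow N n)) :
    ∫ τ, symExt G τ * f τ ∂(dτPow N n) =
      ∑ σ : Perm (Fin n), ∫ τ in simplex N n, G τ * f (τ ∘ σ) ∂(dτPow N n) := by
  rw [integral_congr_ae (g := fun τ => symExtFun G τ * f τ)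
    (by filter_upwards [coeFn_symExt G] with τ h; rw [h]),
    integral_eq_sum_setIntegral_simplex (integrable_mul_of_memLp (memLp_symExtFun G) hf)]
  refine Finset.sum_congr rfl fun σ _ => integral_congr_ae ?_
  filter_upwards [ae_simplex_injective] with τ hτ
  rw [symExtFun_comp_perm, symExtFun_of_mem_simplex _ hτ.2 hτ.1]

/-- Each of the `n!` orderings contributes the same integral over the ordered region. This is where
the `1 / n!` in the Gram matrix of exponential vectors comes from. -/
lemma inner_symExt (G G' : L2Simplex N n) :
    inner ℂ (symExt G) (symExt G') = (n.factorial : ℂ) * inner ℂ G G' := by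
  have h1 : inner ℂ (symExt G) (symExt G') =
      ∫ τ, symExt G' τ * conj (symExtFun G τ) ∂(dτPow N n) := by
    rw [L2.inner_def]
    refine integral_congr_ae ?_
    filter_upwards [coeFn_symExt G] with τ h
    rw [h]; rfl
  rw [h1, integral_symExt_mul (f := fun τ => conj (symExtFun G τ)) (memLp_symExtFun G).star, L2.inner_def]
  have h2 : ∀ σ : Perm (Fin n),
      ∫ τ in simplex N n, G' τ * conj (symExtFun G (τ ∘ σ)) ∂(dτPow N n) =
      ∫ τ in simplex N n, inner ℂ (G τ) (G' τ) ∂(dτPow N n) := by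
    intro σ
    refine integral_congr_ae ?_
    filter_upwards [ae_simplex_injective] with τ hτ
    rw [symExtFun_comp_perm, symExtFun_of_mem_simplex _ hτ.2 hτ.1]
    rfl
  rw [Finset.sum_congr rfl fun σ _ => h2 σ, Finset.sum_const, Finset.card_univ, Fintype.card_perm,
    Fintype.card_fin, nsmul_eq_mul]

lemma norm_symExt_sq (G : L2Simplex N n) : ‖symExt G‖ ^ 2 = n.factorial * ‖G‖ ^ 2 := by
  have := inner_symExt G G
  rw [inner_self_eq_ofReal, inner_self_eq_ofReal] at this
  exact_mod_cast this

end Symmetrization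

/-! ### Tensor products and their restrictions to the ordered region -/

section Tensor

variable {N n : ℕ}

lemma memLp_tensor (v : Fin n → L2Δ N) :
    MemLp (fun τ : Fin n → Δ N => ∏ i, v i (τ i)) 2 (dτPow N n) := by
  have hm : AEStronglyMeasurable (fun τ : Fin n → Δ N => ∏ i, v i (τ i)) (dτPow N n) :=
    Finset.aestronglyMeasurable_fun_prod _ fun i _ =>
      (Lp.aestronglyMeasurable (v i)).comp_quasiMeasurePreserving
        (Measure.quasiMeasurePreserving_eval (fun _ => dτ N) i)
  rw [memLp_two_iff_integrable_sq_norm hm]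
  have : Integrable (fun τ : Fin n → Δ N => ∏ i, ‖v i (τ i)‖ ^ 2) (dτPow N n) :=
    Integrable.fintype_prod (f := fun i x => ‖v i x‖ ^ 2) fun i =>
      (memLp_two_iff_integrable_sq_norm (Lp.aestronglyMeasurable _)).1 (Lp.memLp (v i))
  simpa only [norm_prod, Finset.prod_pow] using this

/-- The tensor product `v₁ ⊗ ⋯ ⊗ vₙ`. -/
noncomputable def tensorLp (v : Fin n → L2Δ N) : L2Pow N n := (memLp_tensor v).toLp

lemma coeFn_tensorLp (v : Fin n → L2Δ N) :
    tensorLp v =ᵐ[dτPow N n] fun τ => ∏ i, v i (τ i) := MemLp.coeFn_toLp _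

lemma inner_tensorLp (v w : Fin n → L2Δ N) :
    inner ℂ (tensorLp v) (tensorLp w) = ∏ i, inner ℂ (v i) (w i) := by
  rw [L2.inner_def]
  simp_rw [L2.inner_def]
  rw [← integral_fintype_prod_eq_prod (μ := fun _ : Fin n => dτ N)
    (fun i x => inner ℂ (v i x) (w i x))]
  refine integral_congr_ae ?_
  filter_upwards [coeFn_tensorLp v, coeFn_tensorLp w] with τ h1 h2
  simp [h1, h2, Finset.prod_mul_distrib, map_prod]

lemma norm_tensorLp (v : Fin n → L2Δ N) : ‖tensorLp v‖ = ∏ i, ‖v i‖ := by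
  have h := inner_tensorLp v v
  simp only [inner_self_eq_ofReal] at h
  have h' : ‖tensorLp v‖ ^ 2 = (∏ i, ‖v i‖) ^ 2 := by
    rw [← Finset.prod_pow]
    exact_mod_cast h
  exact (pow_left_inj₀ (norm_nonneg _) (Finset.prod_nonneg fun _ _ => norm_nonneg _)
    two_ne_zero).1 h'

lemma ae_eval {i : Fin n} {p : Δ N → Prop} (h : ∀ᵐ x ∂(dτ N), p x) :
    ∀ᵐ τ ∂(dτPow N n), p (τ i) :=
  (Measure.quasiMeasurePreserving_eval (fun _ : Fin n => dτ N) i).ae h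

/-- The tensor product as a continuous multilinear map. -/
noncomputable def tensorCMM (N n : ℕ) :
    ContinuousMultilinearMap ℂ (fun _ : Fin n => L2Δ N) (L2Pow N n) :=
  MultilinearMap.mkContinuous
    { toFun := tensorLp
      map_update_add' := by
        intro _ v i x y
        classical
        ext1
        filter_upwards [coeFn_tensorLp (Function.update v i (x + y)),
          coeFn_tensorLp (Function.update v i x), coeFn_tensorLp (Function.update v i y),
          Lp.coeFn_add (tensorLp (Function.update v i x)) (tensorLp (Function.update v i y)),
          ae_eval (i := i) (Lp.coeFn_add x y)] with τ h1 h2 h3 h4 h5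
        have key : ∀ z : L2Δ N, (∏ j, (Function.update v i z) j (τ j)) =
            z (τ i) * ∏ j ∈ Finset.univ \ {i}, v j (τ j) := by
          intro z
          rw [← Finset.prod_update_of_mem (Finset.mem_univ i) (fun j => v j (τ j)) (z (τ i))]
          refine Finset.prod_congr rfl fun j _ => ?_
          by_cases hj : j = i
          · subst hj; simp
          · simp [hj]
        rw [h4, Pi.add_apply, h1, h2, h3, key, key, key, h5, Pi.add_apply, add_mul]
      map_update_smul' := by
        intro _ v i c x
        classical
        ext1
        filter_upwards [coeFn_tensorLp (Function.update v i (c • x)),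
          coeFn_tensorLp (Function.update v i x),
          Lp.coeFn_smul c (tensorLp (Function.update v i x)),
          ae_eval (i := i) (Lp.coeFn_smul c x)] with τ h1 h2 h4 h5
        have key : ∀ z : L2Δ N, (∏ j, (Function.update v i z) j (τ j)) =
            z (τ i) * ∏ j ∈ Finset.univ \ {i}, v j (τ j) := by
          intro z
          rw [← Finset.prod_update_of_mem (Finset.mem_univ i) (fun j => v j (τ j)) (z (τ i))]
          refine Finset.prod_congr rfl fun j _ => ?_
          by_cases hj : j = i
          · subst hj; simp
          · simp [hj]
        rw [h4, Pi.smul_apply, h1, h2, key, key, h5, Pi.smul_apply, smul_eq_mul, smul_eq_mul,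
          mul_assoc] }
    1 fun v => by simp [norm_tensorLp]

@[simp] lemma tensorCMM_apply (v : Fin n → L2Δ N) : tensorCMM N n v = tensorLp v := rfl

/-- The restriction of `h ⊗ ⋯ ⊗ h` to the ordered region. -/
noncomputable def simplexPow (n : ℕ) (h : L2Δ N) : L2Simplex N n :=
  restrictSimplex N n (tensorLp fun _ => h)

lemma coeFn_simplexPow (h : L2Δ N) :
    simplexPow n h =ᵐ[(dτPow N n).restrict (simplex N n)] fun τ => ∏ i, h (τ i) := by
  filter_upwards [LpToLpRestrictCLM_coeFn ℂ (simplex N n) (tensorLp fun _ : Fin n => h),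
    ae_restrict_of_ae (coeFn_tensorLp fun _ : Fin n => h)] with τ h1 h2
  rw [simplexPow, restrictSimplex, h1, h2]

/-- The power `h ⊗ ⋯ ⊗ h` is symmetric, hence recovered from its values on ordered points. Inner
products over `Δ_n` thereby reduce to inner products over `Δⁿ`, which factorize. -/
lemma symExt_simplexPow (h : L2Δ N) : symExt (simplexPow n h) = tensorLp fun _ => h := by
  have h0 : ∀ᵐ τ ∂(dτPow N n), ∀ σ : Perm (Fin n), τ ∘ σ ∈ simplex N n →
      simplexPow n h (τ ∘ σ) = ∏ i, h (τ i) := by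
    rw [ae_all_iff]
    intro σ
    have := (ae_restrict_iff' (measurableSet_simplex n)).1 (coeFn_simplexPow (n := n) h)
    filter_upwards [(measurePreserving_comp_perm (N := N) σ).quasiMeasurePreserving.ae this]
      with τ hτ hS
    rw [hτ hS]
    exact Equiv.prod_comp σ fun i => h (τ i)
  ext1
  filter_upwards [coeFn_symExt (simplexPow n h), coeFn_tensorLp fun _ : Fin n => h,
    ae_times_injective n, h0] with τ h1 h2 h3 h4
  classical
  rw [h1, h2, symExtFun, ← sum_indicator_comp_perm h3 (∏ i, h (τ i))]
  refine Finset.sum_congr rfl fun σ _ => ?_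
  rw [Set.indicator_apply]
  split_ifs with hS
  · exact h4 σ hS
  · rfl

lemma inner_simplexPow (g h : L2Δ N) :
    inner ℂ (simplexPow n g) (simplexPow n h) = (inner ℂ g h) ^ n / (n.factorial : ℂ) := by
  have h1 := inner_symExt (simplexPow n g) (simplexPow n h)
  rw [symExt_simplexPow, symExt_simplexPow, inner_tensorLp, Finset.prod_const,
    Finset.card_univ, Fintype.card_fin] at h1
  rw [h1, mul_div_cancel_left₀ _ (Nat.cast_ne_zero.2 n.factorial_ne_zero)]

lemma norm_simplexPow_sq (h : L2Δ N) :
    ‖simplexPow n h‖ ^ 2 = (‖h‖ ^ 2) ^ n / (n.factorial : ℝ) := by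
  have := inner_simplexPow (n := n) h h
  rw [inner_self_eq_ofReal, inner_self_eq_ofReal] at this
  exact_mod_cast this

end Tensor

/-! ### Fock space, exponential vectors and the entire power series -/

section Fock

variable {N : ℕ}

lemma norm_conjLp {α : Type*} [MeasurableSpace α] {ν : Measure α} (h : Lp ℂ 2 ν) :
    ‖conjLp ν h‖ = ‖h‖ := by
  have hle : ∀ g : Lp ℂ 2 ν, ‖conjLp ν g‖ ≤ ‖g‖ := fun g =>
    Lp.norm_le_norm_of_ae_le (by filter_upwards [coeFn_conjLp g] with x hx; rw [hx]; simp)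
  exact le_antisymm (hle h) (by simpa only [conjLp_conjLp] using hle (conjLp ν h))

/-- The indicator function of `(a, b] × {μ}` as an element of `L²(Δ)`. -/
noncomputable def intervalLp (a b : ℝ≥0) (μ : Fin N) : L2Δ N :=
  indicatorConstLp 2 (measurableSet_Ioc.prod (measurableSet_singleton μ))
    (by rw [dτ_Ioc]; exact ENNReal.ofReal_ne_top) 1 (s := Set.Ioc a b ×ˢ {μ})

lemma coeFn_intervalLp (a b : ℝ≥0) (μ : Fin N) :
    intervalLp a b μ =ᵐ[dτ N] (Set.Ioc a b ×ˢ {μ}).indicator fun _ => (1 : ℂ) :=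
  indicatorConstLp_coeFn

/-- The indicator function of a box is a tensor product. -/
lemma tensorLp_intervalLp {n : ℕ} (a b : Fin n → ℝ≥0) (μ : Fin n → Fin N) :
    tensorLp (fun i => intervalLp (a i) (b i) (μ i)) =ᵐ[dτPow N n]
      (box a b μ).indicator fun _ => (1 : ℂ) := by
  have h : ∀ᵐ τ ∂(dτPow N n), ∀ i, intervalLp (a i) (b i) (μ i) (τ i) =
      (Set.Ioc (a i) (b i) ×ˢ {μ i}).indicator (fun _ => (1 : ℂ)) (τ i) :=
    ae_all_iff.2 fun i => ae_eval (coeFn_intervalLp (a i) (b i) (μ i))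
  filter_upwards [h, coeFn_tensorLp fun i => intervalLp (a i) (b i) (μ i)] with τ h1 h2
  rw [h2]
  classical
  simp_rw [h1, Set.indicator_apply]
  rw [Finset.prod_ite_zero]
  simp [box, Set.mem_pi]

/-- A square integrable kernel on `Δⁿ` is determined by its integrals against product functions. -/
lemma L2Pow_ext {n : ℕ} {k k' : L2Pow N n}
    (h : ∀ v : Fin n → L2Δ N, ∫ τ, k τ * ∏ i, v i (τ i) ∂(dτPow N n) =
      ∫ τ, k' τ * ∏ i, v i (τ i) ∂(dτPow N n)) : k = k' := by
  have hz : (fun τ => k τ - k' τ) =ᵐ[dτPow N n] 0 := by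
    refine ae_eq_zero_of_integral_box_eq_zero ((Lp.memLp k).sub (Lp.memLp k')) fun a b μ _ => ?_
    have hv := h fun i => intervalLp (a i) (b i) (μ i)
    have hmem := memLp_tensor fun i => intervalLp (a i) (b i) (μ i)
    rw [← sub_eq_zero, ← integral_sub (integrable_mul_of_memLp (Lp.memLp k) hmem)
      (integrable_mul_of_memLp (Lp.memLp k') hmem)] at hv
    rw [← integral_indicator (measurableSet_box a b μ), ← hv]
    refine integral_congr_ae ?_
    filter_upwards [tensorLp_intervalLp a b μ, coeFn_tensorLp fun i => intervalLp (a i) (b i) (μ i)]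
      with τ h1 h2
    rw [← h2, h1]
    by_cases hτ : τ ∈ box a b μ <;> simp [hτ]
  ext1
  filter_upwards [hz] with τ hτ
  exact sub_eq_zero.1 hτ

/-- The Fock space `⨁ₙ L²(Δ_n)`. -/
abbrev Fock (N : ℕ) : Type := lp (fun n => L2Simplex N n) 2

/-- The exponential vector `(h ⊗ ⋯ ⊗ h |_{Δ_n})_n`. -/
noncomputable def expVec (h : L2Δ N) : Fock N :=
  ⟨fun n => simplexPow n h, memℓp_gen (by
    simp only [ENNReal.toReal_ofNat, Real.rpow_two, norm_simplexPow_sq]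
    exact Real.summable_pow_div_factorial _)⟩

@[simp] lemma expVec_apply (h : L2Δ N) (n : ℕ) : (expVec h : ∀ n, L2Simplex N n) n = simplexPow n h :=
  rfl

lemma inner_expVec (g h : L2Δ N) :
    inner ℂ (expVec g) (expVec h) = Complex.exp (inner ℂ g h) := by
  have h1 := lp.hasSum_inner (𝕜 := ℂ) (expVec g) (expVec h)
  simp only [expVec_apply, inner_simplexPow] at h1
  have h2 := NormedSpace.expSeries_div_hasSum_exp (inner ℂ g h : ℂ)
  rw [← Complex.exp_eq_exp_ℂ] at h2
  exact h1.unique h2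

/-- The power series `h ↦ ∑ₙ ∫_{Δ_n} Gₙ h ⊗ ⋯ ⊗ h`, in symmetrized form. -/
noncomputable def kernelSeries (G : ∀ n, L2Simplex N n) : FormalMultilinearSeries ℂ (L2Δ N) ℂ :=
  fun n => (n.factorial : ℂ)⁻¹ •
    (innerSL ℂ (conjLp _ (symExt (G n)))).compContinuousMultilinearMap (tensorCMM N n)

lemma kernelSeries_apply (G : ∀ n, L2Simplex N n) (n : ℕ) (v : Fin n → L2Δ N) :
    kernelSeries G n v =
      (n.factorial : ℂ)⁻¹ * ∫ τ, symExt (G n) τ * ∏ i, v i (τ i) ∂(dτPow N n) := by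
  have : kernelSeries G n v = (n.factorial : ℂ)⁻¹ * pairing (symExt (G n)) (tensorLp v) := rfl
  rw [this, pairing_eq_integral]
  congr 1
  refine integral_congr_ae ?_
  filter_upwards [coeFn_tensorLp v] with τ hτ
  rw [hτ]

lemma integral_symExt_tensor_const {n : ℕ} (G : L2Simplex N n) (h : L2Δ N) :
    ∫ τ, symExt G τ * ∏ i, h (τ i) ∂(dτPow N n) = (n.factorial : ℂ) * taylorTerm G h := by
  rw [integral_symExt_mul (memLp_tensor fun _ => h), taylorTerm]
  have : ∀ (σ : Perm (Fin n)) (τ : Fin n → Δ N), ∏ i, h ((τ ∘ σ) i) = ∏ i, h (τ i) :=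
    fun σ τ => Equiv.prod_comp σ fun i => h (τ i)
  simp only [this, Finset.sum_const, Finset.card_univ, Fintype.card_perm, Fintype.card_fin,
    nsmul_eq_mul]

lemma kernelSeries_diag (G : ∀ n, L2Simplex N n) (n : ℕ) (h : L2Δ N) :
    kernelSeries G n (fun _ => h) = taylorTerm (G n) h := by
  rw [kernelSeries_apply, integral_symExt_tensor_const,
    inv_mul_cancel_left₀ (Nat.cast_ne_zero.2 n.factorial_ne_zero)]

lemma inner_simplexPow_conjLp {n : ℕ} (G : L2Simplex N n) (h : L2Δ N) :
    inner ℂ (simplexPow n (conjLp _ h)) G = taylorTerm G h := by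
  rw [L2.inner_def, taylorTerm]
  refine integral_congr_ae ?_
  have h0 : ∀ᵐ τ ∂(dτPow N n), ∀ i, conjLp _ h (τ i) = conj (h (τ i)) :=
    ae_all_iff.2 fun i => ae_eval (coeFn_conjLp h)
  filter_upwards [coeFn_simplexPow (n := n) (conjLp _ h), ae_restrict_of_ae h0] with τ h1 h2
  rw [h1]
  simp [h2]

/-- Symmetric extension multiplies the norm by `√n!`, the coefficient carries `1 / n!`; the
remaining decay `1 / √n!` yields the infinite radius. -/
lemma norm_kernelSeries_le (G : ∀ n, L2Simplex N n) (n : ℕ) :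
    ‖kernelSeries G n‖ ≤ ‖G n‖ / √(n.factorial) := by
  have hf : (0 : ℝ) < n.factorial := by exact_mod_cast n.factorial_pos
  have hs : ‖symExt (G n)‖ = √(n.factorial) * ‖G n‖ := by
    rw [← Real.sqrt_sq (norm_nonneg (symExt (G n))), norm_symExt_sq, Real.sqrt_mul hf.le,
      Real.sqrt_sq (norm_nonneg _)]
  refine ContinuousMultilinearMap.opNorm_le_bound (by positivity) fun v => ?_
  have h1 : kernelSeries G n v = (n.factorial : ℂ)⁻¹ *
    inner ℂ (conjLp _ (symExt (G n))) (tensorLp v) := rfl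
  have h2 := norm_inner_le_norm (𝕜 := ℂ) (conjLp _ (symExt (G n))) (tensorLp v)
  rw [norm_conjLp, norm_tensorLp, hs] at h2
  rw [h1, norm_mul, norm_inv, Complex.norm_natCast]
  calc (n.factorial : ℝ)⁻¹ * ‖inner ℂ (conjLp _ (symExt (G n))) (tensorLp v)‖
      ≤ (n.factorial : ℝ)⁻¹ * (√(n.factorial) * ‖G n‖ * ∏ i, ‖v i‖) := by gcongr
    _ = ‖G n‖ / √(n.factorial) * ∏ i, ‖v i‖ := by
      nth_rw 1 [← Real.mul_self_sqrt hf.le]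
      have : √(n.factorial : ℝ) ≠ 0 := (Real.sqrt_pos.2 hf).ne'
      field_simp

lemma kernelSeries_radius (G : Fock N) : (kernelSeries G).radius = ∞ := by
  refine ENNReal.eq_top_of_forall_nnreal_le fun r => ?_
  refine (kernelSeries G).le_radius_of_bound (‖G‖ * √(Real.exp (r ^ 2))) fun n => ?_
  have hf : (0 : ℝ) < n.factorial := by exact_mod_cast n.factorial_pos
  -- The square of the left side is `(r²)ⁿ / n!`, a single term of the series of `exp (r²)`.
  have h1 : (r : ℝ) ^ n / √(n.factorial) ≤ √(Real.exp (r ^ 2)) := by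
    refine Real.le_sqrt_of_sq_le ?_
    rw [div_pow, Real.sq_sqrt hf.le, ← pow_mul, mul_comm n 2, pow_mul]
    exact Real.pow_div_factorial_le_exp _ (by positivity) n
  calc ‖kernelSeries G n‖ * (r : ℝ) ^ n
      ≤ ‖G n‖ / √(n.factorial) * (r : ℝ) ^ n := by
        gcongr; exact norm_kernelSeries_le _ n
    _ = ‖G n‖ * ((r : ℝ) ^ n / √(n.factorial)) := by ring
    _ ≤ ‖G‖ * √(Real.exp (r ^ 2)) := by
        gcongr
        exact lp.norm_apply_le_norm (by norm_num) G n

/-- This is the inner product of the Fock space read componentwise; conjugating `h` cancels the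
antilinearity of the first slot, so the sum is holomorphic in `h`. -/
lemma hasSum_taylorTerm (G : Fock N) (h : L2Δ N) :
    HasSum (fun n => taylorTerm (G n) h) (inner ℂ (expVec (conjLp _ h)) G) := by
  have := lp.hasSum_inner (𝕜 := ℂ) (expVec (conjLp _ h)) G
  simpa only [expVec_apply, inner_simplexPow_conjLp] using this

lemma hasFPowerSeriesOnBall_kernelSeries (G : Fock N) :
    HasFPowerSeriesOnBall (fun h => inner ℂ (expVec (conjLp _ h)) G) (kernelSeries G) 0 ∞ where
  r_le := (kernelSeries_radius G).ge
  r_pos := ENNReal.zero_lt_top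
  hasSum {h} _ := by
    simpa only [zero_add, kernelSeries_diag] using hasSum_taylorTerm G h

/-- The derivative of a power series sums its coefficient over all permutations of the arguments.
The coefficient is symmetric, so the `n!` equal terms cancel its factor `1 / n!`. -/
lemma iteratedFDeriv_inner_expVec (G : Fock N) (n : ℕ) (v : Fin n → L2Δ N) :
    iteratedFDeriv ℂ n (fun h => inner ℂ (expVec (conjLp _ h)) G) 0 v =
      ∫ τ, symExt (G n) τ * ∏ i, v i (τ i) ∂(dτPow N n) := by
  rw [(hasFPowerSeriesOnBall_kernelSeries G).iteratedFDeriv_eq_sum_of_completeSpace]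
  have h : ∀ σ : Perm (Fin n), kernelSeries G n (fun i => v (σ i)) = kernelSeries G n v := by
    intro σ
    rw [kernelSeries_apply, kernelSeries_apply, integral_symExt_mul (memLp_tensor _),
      integral_symExt_mul (memLp_tensor _), ← Equiv.sum_comp (Equiv.mulRight σ)]
    congr 1
    refine Finset.sum_congr rfl fun ρ _ => integral_congr_ae (Eventually.of_forall fun τ => ?_)
    dsimp only
    congr 1
    rw [← Equiv.prod_comp σ (fun i => v i ((τ ∘ ρ) i))]
    rfl
  rw [Finset.sum_congr rfl fun σ _ => h σ, Finset.sum_const, Finset.card_univ, Fintype.card_perm,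
    Fintype.card_fin, nsmul_eq_mul, kernelSeries_apply,
    mul_inv_cancel_left₀ (Nat.cast_ne_zero.2 n.factorial_ne_zero)]

/-- The entire function attached to `G` vanishes identically, hence so do its derivatives at `0` and
their kernels. This is the totality of exponential vectors. -/
lemma eq_zero_of_inner_expVec_eq_zero {G : Fock N} (h : ∀ g, inner ℂ (expVec g) G = 0) :
    G = 0 := by
  have hz : (fun g => inner ℂ (expVec (conjLp _ g)) G) = fun _ : L2Δ N => (0 : ℂ) := by
    ext g; exact h _
  have hs : ∀ n, symExt (G n) = 0 := by
    intro n
    refine L2Pow_ext fun v => ?_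
    rw [← iteratedFDeriv_inner_expVec G n v, hz, iteratedFDeriv_fun_zero]
    rw [integral_congr_ae (g := fun _ => (0 : ℂ)), integral_zero]
    · rfl
    · filter_upwards [Lp.coeFn_zero ℂ 2 (dτPow N n)] with τ hτ
      rw [hτ]; simp
  ext1
  funext n
  rw [← restrictSimplex_symExt (G n), hs n, map_zero]
  rfl

lemma span_expVec : (Submodule.span ℂ (Set.range (expVec (N := N)))).topologicalClosure = ⊤ :=
  span_closure_eq_top_of_orthogonal fun _ hG =>
    eq_zero_of_inner_expVec_eq_zero fun h => hG _ ⟨h, rfl⟩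

end Fock

/-! ### Isonormal processes and continuity of characteristic functions -/

section Isonormal

variable {Ω : Type*} [MeasurableSpace Ω] {P : Measure Ω}
variable {α : Type*} [MeasurableSpace α] {ν : Measure α}

/-- A complex-linear isonormal Gaussian process indexed by a complex `L²` space. -/
structure IsIsonormal (P : Measure Ω) (U : Lp ℂ 2 ν →ₗᵢ[ℂ] Lp ℂ 2 P) : Prop where
  map_conj : ∀ h, U (conjLp ν h) = conjLp P (U h)
  law : ∀ h, conjLp ν h = h → P.map (fun ω => (U h ω).re) = gaussianReal 0 (‖h‖₊ ^ 2)

lemma ae_real_of_conjLp_eq {f : Lp ℂ 2 P} (hf : conjLp P f = f) :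
    ∀ᵐ ω ∂P, f ω = ((f ω).re : ℂ) := by
  have := coeFn_conjLp f
  rw [hf] at this
  filter_upwards [this] with ω hω
  exact (Complex.conj_eq_iff_re.1 hω.symm).symm

/-- The map is 1-Lipschitz, from `|e^{ia} - e^{ib}| ≤ |a - b|` and `L¹ ≤ L²` for a probability
measure. It carries Gaussian laws from step functions to their `L²` limits. -/
lemma continuous_integral_exp_I_re [IsProbabilityMeasure P] :
    Continuous fun f : Lp ℂ 2 P => ∫ ω, Complex.exp (((f ω).re : ℝ) * Complex.I) ∂P := by
  have hm : ∀ f : Lp ℂ 2 P,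
      Integrable (fun ω => Complex.exp (((f ω).re : ℝ) * Complex.I)) P := by
    intro f
    have h1 : AEStronglyMeasurable (fun ω => Complex.exp (((f ω).re : ℝ) * Complex.I)) P := by
      have := (Lp.aestronglyMeasurable f).aemeasurable
      exact AEMeasurable.aestronglyMeasurable (by fun_prop)
    refine (integrable_const (1 : ℝ)).mono' h1 (Eventually.of_forall fun ω => ?_)
    rw [Complex.norm_exp_ofReal_mul_I]
  refine LipschitzWith.continuous (K := 1) (LipschitzWith.of_dist_le_mul fun f g => ?_)
  rw [dist_eq_norm, ← integral_sub (hm f) (hm g), NNReal.coe_one, one_mul, dist_eq_norm]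
  have hbound : ∀ a b : ℝ,
      ‖Complex.exp (a * Complex.I) - Complex.exp (b * Complex.I)‖ ≤ |a - b| := by
    intro a b
    have h1 : Complex.exp (a * Complex.I) - Complex.exp (b * Complex.I) =
        Complex.exp (b * Complex.I) * (Complex.exp (Complex.I * (a - b : ℝ)) - 1) := by
      rw [mul_sub, ← Complex.exp_add, mul_one]
      congr 2
      push_cast; ring
    rw [h1, norm_mul, Complex.norm_exp_ofReal_mul_I, one_mul]
    exact Real.norm_exp_I_mul_ofReal_sub_one_le
  have hL1 : Integrable (fun ω => ‖(f - g) ω‖) P :=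
    ((Lp.memLp (f - g)).integrable (by norm_num)).norm
  have hL2 : Integrable (fun ω => ‖(f - g) ω‖ ^ 2) P :=
    (memLp_two_iff_integrable_sq_norm (Lp.aestronglyMeasurable _)).1 (Lp.memLp (f - g))
  calc ‖∫ ω, (Complex.exp (((f ω).re : ℝ) * Complex.I) -
        Complex.exp (((g ω).re : ℝ) * Complex.I)) ∂P‖
      ≤ ∫ ω, ‖(f - g) ω‖ ∂P := by
        refine norm_integral_le_of_norm_le hL1 ?_
        filter_upwards [Lp.coeFn_sub f g] with ω hω
        refine (hbound _ _).trans ?_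
        rw [hω, Pi.sub_apply, ← Complex.sub_re]
        exact Complex.abs_re_le_norm _
    _ ≤ ‖f - g‖ := by
        rw [Lp.norm_def]
        have h1 : eLpNorm (f - g : Lp ℂ 2 P) 1 P ≤ eLpNorm (f - g : Lp ℂ 2 P) 2 P :=
          eLpNorm_le_eLpNorm_of_exponent_le (by norm_num) (Lp.aestronglyMeasurable _)
        have h2 := ENNReal.toReal_mono (Lp.eLpNorm_ne_top (f - g)) h1
        rwa [eLpNorm_one_eq_lintegral_enorm, ← integral_norm_eq_lintegral_enorm
          (Lp.aestronglyMeasurable _)] at h2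

end Isonormal

/-! ### The Wiener integral as an isometry with Gaussian values -/

section Brownian

variable {Ω : Type*} [MeasurableSpace Ω] {P : Measure Ω} {N : ℕ}
  {W : Fin N → ℝ≥0 → Ω → ℝ}

namespace IsBrownianMotion

lemma isPre (hW : IsBrownianMotion W P) (μ : Fin N) : IsPreBrownianReal (W μ) P :=
  (hW.isBrownianReal μ).toIsPreBrownianReal

/-- All times occurring in `I` are collected in one finite set `J`. The component vectors over `J`
are Gaussian and independent, hence jointly Gaussian, and the required marginal is a linear image of
them. -/
lemma isGaussian (hW : IsBrownianMotion W P) :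
    IsGaussianProcess (fun (p : Fin N × ℝ≥0) ω => W p.1 p.2 ω) P where
  hasGaussianLaw I := by
    classical
    let J : Finset ℝ≥0 := I.image Prod.snd
    have h1 : ∀ μ, HasGaussianLaw (fun ω => J.restrict (W μ · ω)) P :=
      fun μ => ((hW.isPre μ).hasLaw J).hasGaussianLaw
    have h2 : iIndepFun (fun μ ω => J.restrict (W μ · ω)) P :=
      hW.indep.comp (fun _ => J.restrict) fun _ => Finset.measurable_restrict J
    have h3 := iIndepFun.hasGaussianLaw h1 h2
    have hmem : ∀ p : I, p.1.2 ∈ J := fun p => Finset.mem_image_of_mem _ p.2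
    let L : (Fin N → J → ℝ) →L[ℝ] (I → ℝ) :=
      ContinuousLinearMap.pi fun p =>
        (ContinuousLinearMap.proj (R := ℝ) (φ := fun _ : J => ℝ) ⟨p.1.2, hmem p⟩).comp
          (ContinuousLinearMap.proj (R := ℝ) (φ := fun _ : Fin N => J → ℝ) p.1.1)
    exact h3.map L

lemma memLp (hW : IsBrownianMotion W P) (μ : Fin N) (t : ℝ≥0) : MemLp (W μ t) 2 P :=
  ((hW.isPre μ).hasLaw_eval t).hasGaussianLaw.memLp_two

/-- The value `W^μ_t`, as an element of complex `L²(P)`. -/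
noncomputable def evalLp (hW : IsBrownianMotion W P) (p : ℝ≥0 × Fin N) : Lp ℂ 2 P :=
  ((hW.memLp p.2 p.1).ofReal (K := ℂ)).toLp

lemma coeFn_evalLp (hW : IsBrownianMotion W P) (p : ℝ≥0 × Fin N) :
    hW.evalLp p =ᵐ[P] fun ω => (W p.2 p.1 ω : ℂ) := MemLp.coeFn_toLp _

lemma conjLp_evalLp (hW : IsBrownianMotion W P) (q : ℝ≥0 × Fin N) :
    conjLp P (hW.evalLp q) = hW.evalLp q := by
  ext1
  filter_upwards [coeFn_conjLp (hW.evalLp q), hW.coeFn_evalLp q] with ω h1 h2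
  rw [h1, h2, Complex.conj_ofReal]

variable [IsProbabilityMeasure P]

lemma integral_mul (hW : IsBrownianMotion W P) (μ κ : Fin N) (s t : ℝ≥0) :
    ∫ ω, W μ s ω * W κ t ω ∂P = if μ = κ then ((min s t : ℝ≥0) : ℝ) else 0 := by
  split_ifs with h
  · subst h
    have := (hW.isPre μ).covariance_eval s t
    rw [covariance_eq_sub (hW.memLp μ s) (hW.memLp μ t), (hW.isPre μ).integral_eval] at this
    simpa using this
  · have hind : IndepFun (W μ s) (W κ t) P :=
      (hW.indep.indepFun h).comp (measurable_pi_apply s) (measurable_pi_apply t)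
    have := hind.integral_mul_eq_mul_integral (hW.measurable μ s).aestronglyMeasurable
      (hW.measurable κ t).aestronglyMeasurable
    rw [(hW.isPre μ).integral_eval, zero_mul] at this
    exact this

lemma inner_evalLp (hW : IsBrownianMotion W P) (p q : ℝ≥0 × Fin N) :
    inner ℂ (hW.evalLp p) (hW.evalLp q) =
      ((if p.2 = q.2 then ((min p.1 q.1 : ℝ≥0) : ℝ) else 0 : ℝ) : ℂ) := by
  rw [L2.inner_def, ← hW.integral_mul, ← integral_complex_ofReal]
  refine integral_congr_ae ?_
  filter_upwards [hW.coeFn_evalLp p, hW.coeFn_evalLp q] with ω h1 h2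
  rw [h1, h2]
  simp [mul_comm]

end IsBrownianMotion

lemma inner_intervalLp (a b : ℝ≥0) (μ : Fin N) (g : L2Δ N) :
    inner ℂ (intervalLp a b μ) g = ∫ x in Set.Ioc a b ×ˢ {μ}, g x ∂(dτ N) :=
  L2.inner_indicatorConstLp_one _ _ g

/-- The overlap of two intervals starting at `0` reproduces the Brownian covariance of
`inner_evalLp`; this coincidence of Gram matrices yields the Wiener isometry. -/
lemma inner_intervalLp_zero (p q : ℝ≥0 × Fin N) :
    inner ℂ (intervalLp 0 p.1 p.2) (intervalLp 0 q.1 q.2) =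
      ((if p.2 = q.2 then ((min p.1 q.1 : ℝ≥0) : ℝ) else 0 : ℝ) : ℂ) := by
  have hm : ∀ q : ℝ≥0 × Fin N, MeasurableSet (Set.Ioc (0 : ℝ≥0) q.1 ×ˢ {q.2}) := fun q =>
    measurableSet_Ioc.prod (measurableSet_singleton _)
  rw [inner_intervalLp, integral_congr_ae (ae_restrict_of_ae (coeFn_intervalLp 0 q.1 q.2)),
    integral_indicator (hm q), Measure.restrict_restrict (hm q), integral_const]
  have hset : Set.Ioc (0 : ℝ≥0) q.1 ×ˢ {q.2} ∩ Set.Ioc 0 p.1 ×ˢ {p.2} =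
      if p.2 = q.2 then Set.Ioc 0 (min p.1 q.1) ×ˢ {p.2} else ∅ := by
    ext ⟨s, κ⟩
    split_ifs with h
    · simp [h]; tauto
    · simp only [Set.mem_inter_iff, Set.mem_prod, Set.mem_singleton_iff, Set.mem_empty_iff_false,
        iff_false]
      rintro ⟨⟨-, h1⟩, -, h2⟩
      exact h (h2.symm.trans h1)
  rw [Measure.real, Measure.restrict_apply_univ, hset]
  split_ifs with h
  · rw [dτ_Ioc, ENNReal.toReal_ofReal (by simp)]
    simp
  · simp

lemma intervalLp_eq_sub {a b : ℝ≥0} (hab : a ≤ b) (μ : Fin N) :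
    intervalLp a b μ = intervalLp 0 b μ - intervalLp 0 a μ := by
  ext1
  filter_upwards [coeFn_intervalLp a b μ, coeFn_intervalLp 0 b μ, coeFn_intervalLp 0 a μ,
    Lp.coeFn_sub (intervalLp 0 b μ) (intervalLp 0 a μ)] with x h1 h2 h3 h4
  rw [h4, Pi.sub_apply, h1, h2, h3]
  by_cases hμ : x.2 = μ
  · by_cases ha : x.1 ≤ a
    · by_cases h0 : 0 < x.1 <;> simp [hμ, ha, ha.trans hab, h0, not_lt.2 ha]
    · have ha' := not_le.1 ha
      simp [Set.indicator_apply, hμ, ha, ha', lt_of_le_of_lt zero_le ha']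
  · simp [hμ]

lemma span_intervalLp_zero : (Submodule.span ℂ
    (Set.range fun p : ℝ≥0 × Fin N => intervalLp 0 p.1 p.2)).topologicalClosure = ⊤ := by
  refine span_closure_eq_top_of_orthogonal fun g hg => ?_
  have h0 : ∀ b μ, inner ℂ (intervalLp 0 b μ) g = 0 := fun b μ => hg _ ⟨(b, μ), rfl⟩
  have : g =ᵐ[dτ N] 0 := by
    refine ae_eq_zero_of_integral_Ioc_eq_zero (Lp.memLp g) fun a b μ hab => ?_
    rw [← inner_intervalLp, intervalLp_eq_sub hab, inner_sub_left, h0, h0, sub_zero]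
  exact (Lp.eq_zero_iff_ae_eq_zero).2 this

lemma conjLp_intervalLp (a b : ℝ≥0) (μ : Fin N) :
    conjLp _ (intervalLp a b μ) = intervalLp a b μ := by
  ext1
  filter_upwards [coeFn_conjLp (intervalLp a b μ), coeFn_intervalLp a b μ] with x h1 h2
  rw [h1, h2, Set.indicator_apply]
  split_ifs <;> simp

namespace IsBrownianMotion

variable [IsProbabilityMeasure P]

lemma exists_isometry (hW : IsBrownianMotion W P) : ∃ U : L2Δ N →ₗᵢ[ℂ] Lp ℂ 2 P,
    ∀ p : ℝ≥0 × Fin N, U (intervalLp 0 p.1 p.2) = hW.evalLp p :=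
  exists_linearIsometry_of_inner_eq
    (fun p q => by rw [hW.inner_evalLp, inner_intervalLp_zero]) span_intervalLp_zero

/-- The Wiener integral as a linear isometry. -/
noncomputable def wiener (hW : IsBrownianMotion W P) : L2Δ N →ₗᵢ[ℂ] Lp ℂ 2 P :=
  hW.exists_isometry.choose

lemma wiener_intervalLp_zero (hW : IsBrownianMotion W P) (b : ℝ≥0) (μ : Fin N) :
    hW.wiener (intervalLp 0 b μ) = hW.evalLp (b, μ) :=
  hW.exists_isometry.choose_spec (b, μ)

lemma coeFn_wiener_intervalLp (hW : IsBrownianMotion W P) {a b : ℝ≥0} (hab : a ≤ b) (μ : Fin N) :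
    hW.wiener (intervalLp a b μ) =ᵐ[P] fun ω => ((W μ b ω - W μ a ω : ℝ) : ℂ) := by
  rw [intervalLp_eq_sub hab, map_sub, wiener_intervalLp_zero, wiener_intervalLp_zero]
  filter_upwards [Lp.coeFn_sub (hW.evalLp (b, μ)) (hW.evalLp (a, μ)), hW.coeFn_evalLp (b, μ),
    hW.coeFn_evalLp (a, μ)] with ω h1 h2 h3
  rw [h1, Pi.sub_apply, h2, h3, Complex.ofReal_sub]

lemma wienerIntegral_eq (hW : IsBrownianMotion W P) (h : L2Δ N) :
    wienerIntegral W P h = hW.wiener h := by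
  refine closedExtension_eq hW.wiener.toContinuousLinearMap ?_ ?_ h
  · rintro ⟨f, y⟩ ⟨a, b, μ, hab, hf, hy⟩
    have hf' : f = intervalLp a b μ := by
      ext1; exact hf.trans (coeFn_intervalLp a b μ).symm
    subst hf'
    ext1
    exact hy.trans (hW.coeFn_wiener_intervalLp hab μ).symm
  · rw [eq_top_iff, ← span_intervalLp_zero]
    refine Submodule.topologicalClosure_mono (Submodule.span_mono ?_)
    rintro _ ⟨⟨b, μ⟩, rfl⟩
    exact ⟨(intervalLp 0 b μ, hW.wiener (intervalLp 0 b μ)),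
      ⟨0, b, μ, zero_le, coeFn_intervalLp 0 b μ, hW.coeFn_wiener_intervalLp zero_le μ⟩, rfl⟩

lemma wiener_induction (p : L2Δ N → Prop) (hc : IsClosed {h | p h})
    (hs : ∀ c : (ℝ≥0 × Fin N) →₀ ℂ,
      p (Finsupp.linearCombination ℂ (fun q : ℝ≥0 × Fin N => intervalLp 0 q.1 q.2) c))
    (h : L2Δ N) : p h := by
  have hd : DenseRange
      (Finsupp.linearCombination ℂ (fun q : ℝ≥0 × Fin N => intervalLp 0 q.1 q.2)) := by
    rw [DenseRange, ← LinearMap.coe_range, Finsupp.range_linearCombination,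
      Submodule.dense_iff_topologicalClosure_eq_top, span_intervalLp_zero]
  exact isClosed_property hd hc hs h

lemma wiener_conj (hW : IsBrownianMotion W P) (h : L2Δ N) :
    hW.wiener (conjLp _ h) = conjLp P (hW.wiener h) := by
  refine wiener_induction (fun h => hW.wiener (conjLp _ h) = conjLp P (hW.wiener h))
    (isClosed_eq (by fun_prop) (by fun_prop)) (fun c => ?_) h
  simp only [Finsupp.linearCombination_apply, Finsupp.sum, map_sum, conjLp_smul, conjLp_intervalLp,
    map_smul, wiener_intervalLp_zero, conjLp_evalLp]

lemma reLp_linearCombination (c : (ℝ≥0 × Fin N) →₀ ℂ) :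
    reLp _ (Finsupp.linearCombination ℂ (fun q : ℝ≥0 × Fin N => intervalLp 0 q.1 q.2) c) =
      ∑ q ∈ c.support, ((c q).re : ℂ) • intervalLp 0 q.1 q.2 := by
  rw [Finsupp.linearCombination_apply, Finsupp.sum, map_sum]
  refine Finset.sum_congr rfl fun q _ => ?_
  ext1
  have hr := coeFn_conjLp (intervalLp 0 q.1 q.2)
  rw [conjLp_intervalLp] at hr
  filter_upwards [coeFn_reLp (c q • intervalLp 0 q.1 q.2), hr,
    Lp.coeFn_smul (c q) (intervalLp 0 q.1 q.2),
    Lp.coeFn_smul ((c q).re : ℂ) (intervalLp 0 q.1 q.2)] with x h1 h2 h3 h4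
  rw [h1, h3, h4, Pi.smul_apply, Pi.smul_apply, ← Complex.conj_eq_iff_re.1 h2.symm]
  simp

lemma wiener_reLp_linearCombination (hW : IsBrownianMotion W P) (c : (ℝ≥0 × Fin N) →₀ ℂ) :
    (fun ω => (hW.wiener (reLp _ (Finsupp.linearCombination ℂ
      (fun q : ℝ≥0 × Fin N => intervalLp 0 q.1 q.2) c)) ω).re) =ᵐ[P]
      fun ω => ∑ q ∈ c.support, (c q).re * W q.2 q.1 ω := by
  have h2 : ∀ᵐ ω ∂P, ∀ q : c.support, hW.evalLp q.1 ω = (W q.1.2 q.1.1 ω : ℂ) :=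
    ae_all_iff.2 fun q => hW.coeFn_evalLp q.1
  have h3 : ∀ᵐ ω ∂P, ∀ q : c.support,
      (((c q.1).re : ℂ) • hW.evalLp q.1) ω = ((c q.1).re : ℂ) * hW.evalLp q.1 ω :=
    ae_all_iff.2 fun q => Lp.coeFn_smul _ _
  rw [reLp_linearCombination, map_sum]
  simp only [map_smul, wiener_intervalLp_zero]
  filter_upwards [h2, h3, Lp.coeFn_finsetSum c.support
    (fun q => ((c q).re : ℂ) • hW.evalLp q)] with ω h2 h3 h4
  rw [h4, Finset.sum_apply, Complex.re_sum]
  refine Finset.sum_congr rfl fun q hq => ?_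
  rw [h3 ⟨q, hq⟩, h2 ⟨q, hq⟩]
  simp

lemma hasGaussianLaw_wiener (hW : IsBrownianMotion W P) (c : (ℝ≥0 × Fin N) →₀ ℂ) :
    HasGaussianLaw (fun ω => (hW.wiener (reLp _ (Finsupp.linearCombination ℂ
      (fun q : ℝ≥0 × Fin N => intervalLp 0 q.1 q.2) c)) ω).re) P := by
  have h1 : HasGaussianLaw (fun ω => ∑ q ∈ c.support, (c q).re • W q.2 q.1 ω) P :=
    ((hW.isGaussian.comp_right Prod.swap).smul fun q : ℝ≥0 × Fin N =>
      (c q).re).hasGaussianLaw_fun_sum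
  exact h1.congr (hW.wiener_reLp_linearCombination c).symm

/-- Stated through `reLp h` with `h` arbitrary, the identity is a closed condition on the whole
complex space, so it suffices to check it on step functions, where the integral is a centred
Gaussian sum. -/
lemma integral_exp_wiener_reLp (hW : IsBrownianMotion W P) (h : L2Δ N) :
    ∫ ω, Complex.exp (((hW.wiener (reLp _ h) ω).re : ℝ) * Complex.I) ∂P =
      Complex.exp (-(‖reLp _ h‖ ^ 2 / 2 : ℝ)) := by
  refine wiener_induction (fun h =>
    ∫ ω, Complex.exp (((hW.wiener (reLp _ h) ω).re : ℝ) * Complex.I) ∂P =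
      Complex.exp (-(‖reLp _ h‖ ^ 2 / 2 : ℝ))) (isClosed_eq ?_ ?_) (fun c => ?_) h
  · exact continuous_integral_exp_I_re.comp (hW.wiener.continuous.comp (reLp _).continuous)
  · fun_prop
  · set k := Finsupp.linearCombination ℂ (fun q : ℝ≥0 × Fin N => intervalLp 0 q.1 q.2) c with hk
    have hg := hW.hasGaussianLaw_wiener c
    rw [← hk] at hg
    set f := hW.wiener (reLp _ k) with hf
    have hfreal : ∀ᵐ ω ∂P, f ω = ((f ω).re : ℂ) := by
      refine ae_real_of_conjLp_eq ?_
      rw [hf, ← wiener_conj, conjLp_reLp]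
    have hmean : ∫ ω, (f ω).re ∂P = 0 := by
      rw [hf, hk, integral_congr_ae (hW.wiener_reLp_linearCombination c), integral_finsetSum]
      · refine Finset.sum_eq_zero fun q _ => ?_
        rw [integral_const_mul, (hW.isPre q.2).integral_eval, mul_zero]
      · exact fun q _ => ((hW.isPre q.2).integrable_eval q.1).const_mul _
    have hvar : Var[fun ω => (f ω).re; P] = ‖reLp _ k‖ ^ 2 := by
      rw [variance_of_integral_eq_zero hg.aemeasurable hmean]
      have h1 := inner_self_eq_ofReal f
      rw [L2.inner_def] at h1
      have h2 : ∫ ω, inner ℂ (f ω) (f ω) ∂P = ((∫ ω, (f ω).re ^ 2 ∂P : ℝ) : ℂ) := by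
        rw [← integral_complex_ofReal]
        refine integral_congr_ae ?_
        filter_upwards [hfreal] with ω hω
        rw [hω]
        simp only [sq, RCLike.inner_apply, Complex.conj_ofReal, Complex.ofReal_re, Complex.ofReal_mul]
      rw [h2] at h1
      rw [show ‖f‖ = ‖reLp _ k‖ from hW.wiener.norm_map _] at h1
      exact_mod_cast h1
    have hlaw := hg.map_eq_gaussianReal
    have h1 := complexMGF_gaussianReal hlaw Complex.I
    rw [complexMGF, hmean, hvar] at h1
    rw [show (fun ω => Complex.exp (((f ω).re : ℝ) * Complex.I)) =
      fun ω => Complex.exp (Complex.I * ((f ω).re : ℝ)) from by ext; rw [mul_comm], h1]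
    congr 1
    rw [Complex.I_sq]
    simp
    ring

/-- The Wiener integral is a complex-linear isonormal process. -/
lemma isIsonormal (hW : IsBrownianMotion W P) : IsIsonormal P hW.wiener where
  map_conj := hW.wiener_conj
  law h hh := by
    have hm : AEMeasurable (fun ω => (hW.wiener h ω).re) P :=
      Complex.measurable_re.comp_aemeasurable (Lp.aestronglyMeasurable _).aemeasurable
    have := Measure.isFiniteMeasure_map P (fun ω => (hW.wiener h ω).re)
    refine Measure.ext_of_charFun ?_
    ext t
    rw [← complexMGF_mul_I hm, complexMGF, charFun_gaussianReal]
    have hth : reLp _ ((t : ℂ) • h) = (t : ℂ) • h :=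
      reLp_eq_self (by rw [conjLp_smul, Complex.conj_ofReal, hh])
    have key := hW.integral_exp_wiener_reLp ((t : ℂ) • h)
    rw [hth, map_smul] at key
    have h1 : ∫ ω, Complex.exp (t * Complex.I * ((hW.wiener h ω).re : ℝ)) ∂P =
        ∫ ω, Complex.exp (((((t : ℂ) • hW.wiener h) ω).re : ℝ) * Complex.I) ∂P := by
      refine integral_congr_ae ?_
      filter_upwards [Lp.coeFn_smul (t : ℂ) (hW.wiener h)] with ω hω
      rw [hω]
      congr 1
      simp
      ring
    rw [h1, key]
    congr 1
    rw [norm_smul]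
    simp [mul_pow]
    ring

end IsBrownianMotion

end Brownian

/-! ### Complex Gaussian exponentials and their Gram matrix -/

section Exponentials

variable {Ω : Type*} [MeasurableSpace Ω] {P : Measure Ω}
variable {α : Type*} [MeasurableSpace α] {ν : Measure α}

lemma aemeasurable_coeFn (f : Lp ℂ 2 P) : AEMeasurable f P :=
  (Lp.aestronglyMeasurable f).aemeasurable

namespace IsIsonormal

variable {U : Lp ℂ 2 ν →ₗᵢ[ℂ] Lp ℂ 2 P}

lemma ae_real (hU : IsIsonormal P U) {h : Lp ℂ 2 ν} (hh : conjLp ν h = h) :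
    ∀ᵐ ω ∂P, U h ω = ((U h ω).re : ℂ) :=
  ae_real_of_conjLp_eq (by rw [← hU.map_conj, hh])

lemma integrable_exp_of_real (hU : IsIsonormal P U) {h : Lp ℂ 2 ν} (hh : conjLp ν h = h) :
    Integrable (fun ω => Real.exp (U h ω).re) P := by
  have hm : AEMeasurable (fun ω => (U h ω).re) P :=
    Complex.measurable_re.comp_aemeasurable (aemeasurable_coeFn _)
  have h1 := integrable_exp_mul_gaussianReal (μ := 0) (v := ‖h‖₊ ^ 2) 1
  rw [← hU.law h hh, integrable_map_measure (by fun_prop) hm] at h1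
  simpa [Function.comp_def] using h1

lemma ae_decomp (U : Lp ℂ 2 ν →ₗᵢ[ℂ] Lp ℂ 2 P) (u v : Lp ℂ 2 ν) (z : ℂ) :
    ∀ᵐ ω ∂P, U (u + z • v) ω = U u ω + z * U v ω := by
  rw [map_add, map_smul]
  filter_upwards [Lp.coeFn_add (U u) (z • U v), Lp.coeFn_smul z (U v)] with ω h1 h2
  rw [h1, Pi.add_apply, h2, Pi.smul_apply, smul_eq_mul]

lemma ae_re_eq (hU : IsIsonormal P U) (h : Lp ℂ 2 ν) :
    ∀ᵐ ω ∂P, (U h ω).re = (U (reLp ν h) ω).re := by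
  have := ae_decomp U (reLp ν h) (imLp ν h) Complex.I
  rw [reLp_add_imLp] at this
  filter_upwards [this, hU.ae_real (conjLp_imLp h)] with ω h1 h2
  rw [h1, h2]
  simp

lemma integrable_exp_re (hU : IsIsonormal P U) (h : Lp ℂ 2 ν) :
    Integrable (fun ω => Real.exp (U h ω).re) P := by
  refine (hU.integrable_exp_of_real (conjLp_reLp h)).congr ?_
  filter_upwards [hU.ae_re_eq h] with ω hω
  rw [hω]

lemma integrable_exp (hU : IsIsonormal P U) (h : Lp ℂ 2 ν) :
    Integrable (fun ω => Complex.exp (U h ω)) P := by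
  refine (hU.integrable_exp_re h).mono'
    (Complex.measurable_exp.comp_aemeasurable (aemeasurable_coeFn _)).aestronglyMeasurable ?_
  exact Eventually.of_forall fun ω => by rw [Complex.norm_exp]

lemma integral_exp_of_real (hU : IsIsonormal P U) {h : Lp ℂ 2 ν} (hh : conjLp ν h = h) :
    ∫ ω, Real.exp (U h ω).re ∂P = Real.exp (‖h‖ ^ 2 / 2) := by
  have := mgf_gaussianReal (hU.law h hh) 1
  simpa [mgf] using this

lemma pairing_expand {u v : Lp ℂ 2 ν} (hu : conjLp ν u = u) (hv : conjLp ν v = v) :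
    ∃ m : ℝ, ∀ z : ℂ, pairing (u + z • v) (u + z • v) =
      (‖u‖ ^ 2 : ℝ) + 2 * z * m + z ^ 2 * (‖v‖ ^ 2 : ℝ) := by
  refine ⟨(pairing u v).re, fun z => ?_⟩
  have hreal : ((pairing u v).re : ℂ) = pairing u v := by
    refine Complex.conj_eq_iff_re.1 ?_
    rw [conj_pairing, hu, hv]
  rw [hreal, pairing_add_left, pairing_add_right, pairing_add_right, pairing_smul_left,
    pairing_smul_left, pairing_smul_right, pairing_smul_right, pairing_comm v u,
    pairing_self_of_real hu, pairing_self_of_real hv]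
  ring

lemma conjLp_add_smul_real {u v : Lp ℂ 2 ν} (hu : conjLp ν u = u) (hv : conjLp ν v = v) (t : ℝ) :
    conjLp ν (u + (t : ℂ) • v) = u + (t : ℂ) • v := by
  rw [map_add, conjLp_smul, hu, hv, Complex.conj_ofReal]

/-- Write `h = u + i v` with `u`, `v` real. Under `P` tilted by `exp U(u)`, the moment generating
function of `U(v)` is Gaussian with mean `∫ u v` and variance `‖v‖²`. It is finite on all of `ℝ`, so
the equality continues analytically to the argument `i`, which gives `exp (U u + i U v)`. -/
lemma integral_exp [IsProbabilityMeasure P] (hU : IsIsonormal P U) (h : Lp ℂ 2 ν) :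
    ∫ ω, Complex.exp (U h ω) ∂P = Complex.exp (pairing h h / 2) := by
  set u := reLp ν h
  set v := imLp ν h
  have hu : conjLp ν u = u := conjLp_reLp h
  have hv : conjLp ν v = v := conjLp_imLp h
  have huv : u + Complex.I • v = h := reLp_add_imLp h
  obtain ⟨m, hm⟩ := pairing_expand hu hv
  set X : Ω → ℝ := fun ω => (U u ω).re with hX
  set Y : Ω → ℝ := fun ω => (U v ω).re with hY
  have hXi : Integrable (fun ω => Real.exp (X ω)) P := hU.integrable_exp_of_real hu
  have hXv : ∫ ω, Real.exp (X ω) ∂P = Real.exp (‖u‖ ^ 2 / 2) := hU.integral_exp_of_real hu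
  have hsum : ∀ t : ℝ, ∀ᵐ ω ∂P, (U (u + (t : ℂ) • v) ω).re = X ω + t * Y ω := by
    intro t
    filter_upwards [ae_decomp U u v t] with ω hω
    rw [hω]
    simp [hX, hY]
  have hprob : IsProbabilityMeasure (P.tilted X) := isProbabilityMeasure_tilted hXi
  have hexp : ∀ t : ℝ, Integrable (fun ω => Real.exp (t * Y ω)) (P.tilted X) := by
    intro t
    rw [integrable_tilted_iff hXi]
    refine (hU.integrable_exp_of_real (conjLp_add_smul_real hu hv t)).congr ?_
    filter_upwards [hsum t] with ω hω
    rw [hω, Real.exp_add, smul_eq_mul]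
  have hmgf : mgf Y (P.tilted X) = mgf id (gaussianReal m (‖v‖₊ ^ 2)) := by
    ext t
    rw [mgf_id_gaussianReal, mgf, integral_tilted, hXv]
    have h1 : ∀ ω, (Real.exp (X ω) / Real.exp (‖u‖ ^ 2 / 2)) • Real.exp (t * Y ω) =
        (Real.exp (‖u‖ ^ 2 / 2))⁻¹ * Real.exp (X ω + t * Y ω) := by
      intro ω
      rw [Real.exp_add, smul_eq_mul]; ring
    simp_rw [h1]
    rw [integral_const_mul, integral_congr_ae (g := fun ω => Real.exp (U (u + (t : ℂ) • v) ω).re)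
      (by filter_upwards [hsum t] with ω hω; rw [hω]),
      hU.integral_exp_of_real (conjLp_add_smul_real hu hv t), ← Real.exp_neg, ← Real.exp_add]
    have h2 := hm t
    rw [pairing_self_of_real (conjLp_add_smul_real hu hv t)] at h2
    have h3 : ‖u + (t : ℂ) • v‖ ^ 2 = ‖u‖ ^ 2 + 2 * t * m + t ^ 2 * ‖v‖ ^ 2 := by exact_mod_cast h2
    rw [h3]
    congr 1
    push_cast
    ring
  have hset : integrableExpSet Y (P.tilted X) = Set.univ := Set.eq_univ_of_forall hexp
  have hc := eqOn_complexMGF_of_mgf hmgf (x := Complex.I)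
    (by rw [Set.mem_ofPred_eq, hset, interior_univ]; trivial)
  rw [complexMGF_id_gaussianReal, complexMGF, integral_tilted, hXv] at hc
  have h1 : ∀ᵐ ω ∂P, (Real.exp (X ω) / Real.exp (‖u‖ ^ 2 / 2)) • Complex.exp (Complex.I * Y ω) =
      Complex.exp (-(‖u‖ ^ 2 / 2 : ℝ)) * Complex.exp (U h ω) := by
    have := ae_decomp U u v Complex.I
    rw [huv] at this
    filter_upwards [this, hU.ae_real hu, hU.ae_real hv] with ω h1 h2 h3
    rw [h1, h2, h3, Complex.exp_add, ← Real.exp_sub, Complex.real_smul, Complex.ofReal_exp,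
      sub_eq_add_neg, Complex.ofReal_add, Complex.exp_add]
    simp only [hX, hY]
    push_cast
    ring
  rw [integral_congr_ae h1, integral_const_mul] at hc
  have h2 : Complex.exp (-(‖u‖ ^ 2 / 2 : ℝ)) ≠ 0 := Complex.exp_ne_zero _
  refine mul_left_cancel₀ h2 (hc.trans ?_)
  rw [← Complex.exp_add]
  have h3 := hm Complex.I
  rw [huv] at h3
  rw [h3]
  congr 1
  push_cast
  rw [Complex.I_sq]
  simp
  ring

/-- The renormalized exponential `exp(U(h) - ½ ∫ h²)` as a function on `Ω`. -/
noncomputable def wickExp (U : Lp ℂ 2 ν →ₗᵢ[ℂ] Lp ℂ 2 P) (h : Lp ℂ 2 ν) (ω : Ω) : ℂ :=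
  Complex.exp (U h ω - pairing h h / 2)

lemma wickExp_eq (U : Lp ℂ 2 ν →ₗᵢ[ℂ] Lp ℂ 2 P) (h : Lp ℂ 2 ν) (ω : Ω) :
    wickExp U h ω = Complex.exp (-(pairing h h / 2)) * Complex.exp (U h ω) := by
  rw [wickExp, sub_eq_add_neg, Complex.exp_add, mul_comm]

lemma aestronglyMeasurable_exp (U : Lp ℂ 2 ν →ₗᵢ[ℂ] Lp ℂ 2 P) (h : Lp ℂ 2 ν) :
    AEStronglyMeasurable (fun ω => Complex.exp (U h ω)) P :=
  (Complex.measurable_exp.comp_aemeasurable (aemeasurable_coeFn _)).aestronglyMeasurable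

lemma memLp_exp (hU : IsIsonormal P U) (h : Lp ℂ 2 ν) :
    MemLp (fun ω => Complex.exp (U h ω)) 2 P := by
  rw [memLp_two_iff_integrable_sq_norm (aestronglyMeasurable_exp U h)]
  refine (hU.integrable_exp_re (h + h)).congr ?_
  rw [map_add]
  filter_upwards [Lp.coeFn_add (U h) (U h)] with ω hω
  rw [hω, Pi.add_apply, Complex.norm_exp, Complex.add_re, Real.exp_add, sq]

lemma memLp_wickExp (hU : IsIsonormal P U) (h : Lp ℂ 2 ν) : MemLp (wickExp U h) 2 P := by
  have := (hU.memLp_exp h).const_mul (Complex.exp (-(pairing h h / 2)))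
  exact this.ae_eq (Eventually.of_forall fun ω => (wickExp_eq U h ω).symm)

/-- The renormalized exponential as an element of `L²(P)`. -/
noncomputable def wickLp (hU : IsIsonormal P U) (h : Lp ℂ 2 ν) : Lp ℂ 2 P :=
  (hU.memLp_wickExp h).toLp

lemma coeFn_wickLp (hU : IsIsonormal P U) (h : Lp ℂ 2 ν) : hU.wickLp h =ᵐ[P] wickExp U h :=
  MemLp.coeFn_toLp _

lemma conjLp_wickLp (hU : IsIsonormal P U) (h : Lp ℂ 2 ν) :
    conjLp P (hU.wickLp h) = hU.wickLp (conjLp ν h) := by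
  ext1
  have h3 := coeFn_conjLp (U h)
  rw [← hU.map_conj] at h3
  filter_upwards [coeFn_conjLp (hU.wickLp h), hU.coeFn_wickLp h, hU.coeFn_wickLp (conjLp ν h), h3]
    with ω h1 h2 h3 h4
  rw [h1, h2, h3, wickExp, wickExp, h4, ← Complex.exp_conj, map_sub, map_div₀, conj_pairing,
    Complex.conj_ofNat]

/-- Half the square of `g + h` minus the two subtracted halves leaves exactly the cross term. -/
lemma pairing_wickLp [IsProbabilityMeasure P] (hU : IsIsonormal P U) (g h : Lp ℂ 2 ν) :
    pairing (hU.wickLp g) (hU.wickLp h) = Complex.exp (pairing g h) := by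
  rw [pairing_eq_integral]
  have h1 : ∀ᵐ ω ∂P, hU.wickLp g ω * hU.wickLp h ω =
      Complex.exp (-(pairing g g / 2) - pairing h h / 2) * Complex.exp (U (g + h) ω) := by
    rw [map_add]
    filter_upwards [hU.coeFn_wickLp g, hU.coeFn_wickLp h, Lp.coeFn_add (U g) (U h)] with ω h1 h2 h3
    rw [h1, h2, h3, Pi.add_apply, wickExp, wickExp, ← Complex.exp_add, ← Complex.exp_add]
    congr 1
    ring
  rw [integral_congr_ae h1, integral_const_mul, hU.integral_exp, ← Complex.exp_add,
    pairing_add_left, pairing_add_right, pairing_add_right, pairing_comm h g]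
  congr 1
  ring

lemma inner_wickLp [IsProbabilityMeasure P] (hU : IsIsonormal P U) (g h : Lp ℂ 2 ν) :
    inner ℂ (hU.wickLp g) (hU.wickLp h) = Complex.exp (inner ℂ g h) := by
  rw [inner_eq_pairing, hU.conjLp_wickLp, hU.pairing_wickLp, ← inner_eq_pairing]

end IsIsonormal

end Exponentials

/-! ### Correlations of products of Wiener integrals with exponentials -/

section Moments

variable {Ω : Type*} [MeasurableSpace Ω] {P : Measure Ω}
variable {α : Type*} [MeasurableSpace α] {ν : Measure α}

lemma abs_le_exp_add_exp_neg (x : ℝ) : |x| ≤ Real.exp x + Real.exp (-x) := by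
  have h1 := Real.add_one_le_exp x
  have h2 := Real.add_one_le_exp (-x)
  have h3 := Real.exp_pos x
  have h4 := Real.exp_pos (-x)
  rw [abs_le]
  constructor <;> linarith

lemma abs_mul_exp_le {x t : ℝ} (ht : |t| ≤ 1) :
    |x| * Real.exp (t * x) ≤ Real.exp (2 * x) + Real.exp (-(2 * x)) := by
  have h1 : |x| ≤ Real.exp |x| := by linarith [Real.add_one_le_exp |x|]
  have h2 : Real.exp (t * x) ≤ Real.exp |x| := by
    refine Real.exp_le_exp.2 ((le_abs_self _).trans ?_)
    rw [abs_mul]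
    exact mul_le_of_le_one_left (abs_nonneg x) ht
  calc |x| * Real.exp (t * x) ≤ Real.exp |x| * Real.exp |x| := by gcongr
    _ = Real.exp (2 * |x|) := by rw [← Real.exp_add]; ring_nf
    _ ≤ Real.exp (2 * x) + Real.exp (-(2 * x)) := by
      rcases abs_cases x with ⟨h, -⟩ | ⟨h, -⟩ <;> rw [h]
      · linarith [Real.exp_pos (-(2 * x))]
      · rw [mul_neg]; linarith [Real.exp_pos (2 * x)]

namespace IsIsonormal

variable {U : Lp ℂ 2 ν →ₗᵢ[ℂ] Lp ℂ 2 P}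

lemma ae_norm_mul_exp (hU : IsIsonormal P U) (Y : Ω → ℂ) {e : Lp ℂ 2 ν} (he : conjLp ν e = e)
    (h : Lp ℂ 2 ν) (t : ℝ) :
    ∀ᵐ ω ∂P, ‖Y ω * Complex.exp (U (h + (t : ℂ) • e) ω)‖ =
      ‖Y ω‖ * Real.exp (U h ω).re * Real.exp (t * (U e ω).re) := by
  filter_upwards [ae_decomp U h e t, hU.ae_real he] with ω h1 h2
  rw [h1, norm_mul, Complex.norm_exp, Complex.add_re, Real.exp_add, mul_assoc]
  simp

/-- By `|x| ≤ e^x + e^{-x}` the extra factor `U e` is absorbed in exponentials at `h ± e`. Assuming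
integrability for every `h` lets the argument be iterated over the factors of a product. -/
lemma integrable_mul_exp (hU : IsIsonormal P U) {Y : Ω → ℂ} (hm : AEStronglyMeasurable Y P)
    (hY : ∀ h, Integrable (fun ω => Y ω * Complex.exp (U h ω)) P) {e : Lp ℂ 2 ν}
    (he : conjLp ν e = e) (h : Lp ℂ 2 ν) :
    Integrable (fun ω => U e ω * Y ω * Complex.exp (U h ω)) P := by
  refine ((hY (h + ((1 : ℝ) : ℂ) • e)).norm.add (hY (h + ((-1 : ℝ) : ℂ) • e)).norm).mono'
    (((Lp.aestronglyMeasurable _).mul hm).mul (aestronglyMeasurable_exp U h)) ?_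
  filter_upwards [hU.ae_norm_mul_exp Y he h 1, hU.ae_norm_mul_exp Y he h (-1), hU.ae_real he]
    with ω h1 h2 h3
  rw [Pi.add_apply, h1, h2, h3, norm_mul, norm_mul, Complex.norm_exp, Complex.norm_real,
    Real.norm_eq_abs, ← mul_add, mul_assoc, mul_comm |_|, one_mul, neg_one_mul]
  gcongr
  exact abs_le_exp_add_exp_neg _

/-- Differentiation under the integral: for `|t| ≤ 1`, `abs_mul_exp_le` dominates the derivative by
exponentials at `h ± 2 e`. -/
lemma hasDerivAt_integral_mul_exp (hU : IsIsonormal P U) {Y : Ω → ℂ}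
    (hm : AEStronglyMeasurable Y P)
    (hY : ∀ h, Integrable (fun ω => Y ω * Complex.exp (U h ω)) P) {e : Lp ℂ 2 ν}
    (he : conjLp ν e = e) (h : Lp ℂ 2 ν) :
    HasDerivAt (fun t : ℝ => ∫ ω, Y ω * Complex.exp (U (h + (t : ℂ) • e) ω) ∂P)
      (∫ ω, U e ω * Y ω * Complex.exp (U h ω) ∂P) 0 := by
  have hF : ∀ t : ℝ, ∀ᵐ ω ∂P, Y ω * Complex.exp (U (h + (t : ℂ) • e) ω) =
      Y ω * Complex.exp (U h ω + t * U e ω) := by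
    intro t
    filter_upwards [ae_decomp U h e t] with ω hω
    rw [hω]
  have hF' : (fun t : ℝ => ∫ ω, Y ω * Complex.exp (U (h + (t : ℂ) • e) ω) ∂P) =
      fun t : ℝ => ∫ ω, Y ω * Complex.exp (U h ω + t * U e ω) ∂P := by
    ext t
    exact integral_congr_ae (hF t)
  rw [hF']
  have hmU : ∀ t : ℝ, AEStronglyMeasurable (fun ω => Complex.exp (U h ω + t * U e ω)) P := by
    intro t
    have h1 := aemeasurable_coeFn (U h)
    have h2 := aemeasurable_coeFn (U e)
    exact AEMeasurable.aestronglyMeasurable (by fun_prop)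
  have key := hasDerivAt_integral_of_dominated_loc_of_deriv_le (μ := P) (x₀ := (0 : ℝ))
    (s := Metric.ball 0 1)
    (F := fun (t : ℝ) ω => Y ω * Complex.exp (U h ω + t * U e ω))
    (F' := fun (t : ℝ) ω => U e ω * Y ω * Complex.exp (U h ω + t * U e ω))
    (bound := fun ω => ‖Y ω * Complex.exp (U (h + ((2 : ℝ) : ℂ) • e) ω)‖ +
      ‖Y ω * Complex.exp (U (h + ((-2 : ℝ) : ℂ) • e) ω)‖)
    (Metric.ball_mem_nhds _ one_pos)
    (Eventually.of_forall fun t => hm.mul (hmU t))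
    ((hY _).congr (hF 0))
    (((Lp.aestronglyMeasurable _).mul hm).mul (hmU 0)) ?_
    ((hY _).norm.add (hY _).norm) ?_
  · simpa using key.2
  · filter_upwards [hU.ae_norm_mul_exp Y he h 2, hU.ae_norm_mul_exp Y he h (-2), hU.ae_real he]
      with ω h1 h2 h3 t ht
    have h5 : ‖U e ω‖ = |(U e ω).re| := by
      rw [h3, Complex.norm_real, Real.norm_eq_abs, Complex.ofReal_re]
    have h4 : (U h ω + (t : ℂ) * U e ω).re = (U h ω).re + t * (U e ω).re := by simp
    rw [h1, h2, norm_mul, norm_mul, Complex.norm_exp, h5, ← mul_add, h4, Real.exp_add]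
    have ht' : |t| ≤ 1 := by
      rw [Metric.mem_ball, dist_zero_right, Real.norm_eq_abs] at ht
      exact ht.le
    calc |(U e ω).re| * ‖Y ω‖ * (Real.exp (U h ω).re * Real.exp (t * (U e ω).re))
        = ‖Y ω‖ * Real.exp (U h ω).re * (|(U e ω).re| * Real.exp (t * (U e ω).re)) := by ring
      _ ≤ _ := by
        rw [neg_mul]
        gcongr
        exact abs_mul_exp_le ht'
  · refine Eventually.of_forall fun ω t _ => ?_
    have h1 : HasDerivAt (fun t : ℝ => U h ω + (t : ℂ) * U e ω) (U e ω) t := by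
      simpa using ((hasDerivAt_id t).ofReal_comp.mul_const (U e ω)).const_add (U h ω)
    have h2 := h1.cexp.const_mul (Y ω)
    rwa [show Y ω * (Complex.exp (U h ω + t * U e ω) * U e ω) =
      U e ω * Y ω * Complex.exp (U h ω + t * U e ω) by ring] at h2

lemma integrable_prod_mul_exp [IsProbabilityMeasure P] (hU : IsIsonormal P U) {ι : Type*}
    {e : ι → Lp ℂ 2 ν} (he : ∀ i, conjLp ν (e i) = e i) (s : Finset ι) (h : Lp ℂ 2 ν) :
    Integrable (fun ω => (∏ i ∈ s, U (e i) ω) * Complex.exp (U h ω)) P := by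
  classical
  induction s using Finset.induction_on generalizing h with
  | empty => simpa only [Finset.prod_empty, one_mul] using hU.integrable_exp h
  | insert k s hk ih =>
    simp only [Finset.prod_insert hk]
    exact hU.integrable_mul_exp
      (Finset.aestronglyMeasurable_fun_prod _ fun i _ => Lp.aestronglyMeasurable _) ih (he k) h

lemma memLp_prod [IsProbabilityMeasure P] (hU : IsIsonormal P U) {ι : Type*} [Fintype ι]
    {e : ι → Lp ℂ 2 ν} (he : ∀ i, conjLp ν (e i) = e i) :
    MemLp (fun ω => ∏ i, U (e i) ω) 2 P := by
  refine (memLp_two_iff_integrable_sq_norm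
    (Finset.aestronglyMeasurable_fun_prod _ fun i _ => Lp.aestronglyMeasurable _)).2 ?_
  -- Indexing by two copies of `ι` squares the product, and the argument `0` trivializes the
  -- exponential.
  have h := (hU.integrable_prod_mul_exp (e := Sum.elim e e) (by rintro (i | i) <;> exact he i)
    Finset.univ 0).norm
  refine h.congr (Eventually.of_forall fun ω => ?_)
  simp [Fintype.prod_sum_type, sq]

/-- For orthogonal real `eᵢ`, the correlation of `∏ U(eᵢ)` with an exponential. -/
lemma integral_prod_mul_exp [IsProbabilityMeasure P] (hU : IsIsonormal P U) {ι : Type*}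
    {e : ι → Lp ℂ 2 ν} (he : ∀ i, conjLp ν (e i) = e i)
    (horth : ∀ i j, i ≠ j → pairing (e i) (e j) = 0) (s : Finset ι) (h : Lp ℂ 2 ν) :
    ∫ ω, (∏ i ∈ s, U (e i) ω) * Complex.exp (U h ω) ∂P =
      (∏ i ∈ s, pairing (e i) h) * Complex.exp (pairing h h / 2) := by
  classical
  induction s using Finset.induction_on generalizing h with
  | empty => simpa only [Finset.prod_empty, one_mul] using hU.integral_exp h
  | insert k s hk ih =>
    have hm : AEStronglyMeasurable (fun ω => ∏ i ∈ s, U (e i) ω) P :=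
      Finset.aestronglyMeasurable_fun_prod _ fun i _ => Lp.aestronglyMeasurable _
    simp only [Finset.prod_insert hk]
    -- The new factor is produced by differentiating the induction hypothesis along `e k`. By
    -- orthogonality the earlier factors do not vary, so only the exponential contributes.
    have h1 := hU.hasDerivAt_integral_mul_exp hm (hU.integrable_prod_mul_exp he s) (he k) h
    simp only [ih] at h1
    have h2 : (fun t : ℝ => (∏ i ∈ s, pairing (e i) (h + (t : ℂ) • e k)) *
        Complex.exp (pairing (h + (t : ℂ) • e k) (h + (t : ℂ) • e k) / 2)) =
        fun t : ℝ => (∏ i ∈ s, pairing (e i) h) * Complex.exp ((pairing h h +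
          2 * (t * pairing (e k) h) + (t : ℂ) ^ 2 * pairing (e k) (e k)) / 2) := by
      ext t
      congr 1
      · refine Finset.prod_congr rfl fun i hi => ?_
        have hik : i ≠ k := fun h => hk (h ▸ hi)
        rw [pairing_add_right, pairing_smul_right, horth i k hik, mul_zero, add_zero]
      · rw [pairing_add_left, pairing_add_right, pairing_add_right, pairing_smul_left,
          pairing_smul_left, pairing_smul_right, pairing_smul_right, pairing_comm h (e k)]
        congr 2
        ring
    rw [h2] at h1
    have h3 : HasDerivAt (fun t : ℝ => (pairing h h +
          2 * (t * pairing (e k) h) + (t : ℂ) ^ 2 * pairing (e k) (e k)) / 2)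
        (pairing (e k) h) 0 := by
      have a1 : HasDerivAt (fun t : ℝ => (t : ℂ)) 1 0 := by
        simpa using (hasDerivAt_id (0 : ℝ)).ofReal_comp
      have a2 := (((a1.mul_const (pairing (e k) h)).const_mul 2).const_add (pairing h h)).add
        ((a1.pow 2).mul_const (pairing (e k) (e k)))
      refine (a2.div_const 2).congr_deriv ?_
      simp
    have h4 := h3.cexp.const_mul (∏ i ∈ s, pairing (e i) h)
    rw [h1.unique h4]
    simp
    ring

end IsIsonormal

end Moments

/-! ### Uniqueness of Fourier transforms in infinitely many variables -/

section CharacteristicFunctions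

variable {Ω : Type*} [MeasurableSpace Ω] {P : Measure Ω}

lemma integral_withDensity_ofReal {y : Ω → ℝ} (hy : Integrable y P) (f : Ω → ℂ) :
    ∫ ω, f ω ∂(P.withDensity fun ω => ENNReal.ofReal (y ω)) =
      ∫ ω, ((max (y ω) 0 : ℝ) : ℂ) * f ω ∂P := by
  rw [integral_withDensity_eq_integral_toReal_smul₀ hy.aemeasurable.ennreal_ofReal
    (Eventually.of_forall fun _ => ENNReal.ofReal_lt_top)]
  refine integral_congr_ae (Eventually.of_forall fun ω => ?_)
  simp only [ENNReal.toReal_ofReal', Complex.real_smul]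

/-- An integrable function which is orthogonal to all trigonometric polynomials in a family of
random variables integrates to `0` over the sets of the generated σ-algebra. -/
lemma setIntegral_eq_zero_of_integral_exp_eq_zero {T : Type*} {Z : T → Ω → ℝ}
    (hZ : ∀ t, Measurable (Z t)) {y : Ω → ℝ} (hy : Integrable y P)
    (h : ∀ (I : Finset T) (c : T → ℝ),
      ∫ ω, (y ω : ℂ) * Complex.exp ((∑ t ∈ I, c t * Z t ω : ℝ) * Complex.I) ∂P = 0)
    {A : Set Ω} (hA : MeasurableSet[MeasurableSpace.comap (fun ω t => Z t ω) MeasurableSpace.pi] A) :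
    ∫ ω in A, y ω ∂P = 0 := by
  classical
  set Φ : Ω → T → ℝ := fun ω t => Z t ω
  have hΦ : Measurable Φ := measurable_pi_lambda _ hZ
  -- The positive and negative parts of `y` as densities; the claim becomes the equality of two
  -- finite measures on path space.
  set μ₁ := P.withDensity fun ω => ENNReal.ofReal (y ω)
  set μ₂ := P.withDensity fun ω => ENNReal.ofReal (-y ω)
  have hf₁ : IsFiniteMeasure μ₁ := isFiniteMeasure_withDensity_ofReal hy.2
  have hf₂ : IsFiniteMeasure μ₂ := isFiniteMeasure_withDensity_ofReal hy.neg.2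
  have hfin : ∀ I : Finset T, (μ₁.map Φ).map I.restrict = (μ₂.map Φ).map I.restrict := by
    intro I
    have hr : Measurable (I.restrict (π := fun _ : T => ℝ)) := Finset.measurable_restrict I
    refine Measure.ext_of_charFunDual ?_
    ext L
    rw [charFunDual_apply, charFunDual_apply, Measure.map_map hr hΦ, Measure.map_map hr hΦ,
      integral_map (hr.comp hΦ).aemeasurable (by fun_prop),
      integral_map (hr.comp hΦ).aemeasurable (by fun_prop),
      integral_withDensity_ofReal hy, integral_withDensity_ofReal (y := fun ω => -y ω) hy.neg, ← sub_eq_zero]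
    have hL : ∀ ω, L ((I.restrict ∘ Φ) ω) =
        ∑ t ∈ I, (if ht : t ∈ I then L (Pi.single ⟨t, ht⟩ 1) else 0) * Z t ω := by
      intro ω
      rw [← Finset.sum_attach, ← LinearMap.sum_single_apply (fun _ : I => ℝ) ((I.restrict ∘ Φ) ω),
        map_sum]
      refine Finset.sum_congr rfl fun t _ => ?_
      rw [dif_pos t.2]
      have : (Pi.single t ((I.restrict ∘ Φ) ω t) : I → ℝ) =
          (Z t ω) • (Pi.single t (1 : ℝ) : I → ℝ) := by
        rw [← Pi.single_smul]; simp [Φ]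
      rw [this, map_smul, smul_eq_mul, mul_comm]
    have hm : AEStronglyMeasurable
        (fun ω => Complex.exp (L ((I.restrict ∘ Φ) ω) * Complex.I)) P := by
      have : Measurable fun ω => L ((I.restrict ∘ Φ) ω) := L.measurable.comp (hr.comp hΦ)
      exact Measurable.aestronglyMeasurable (by fun_prop)
    have hint : ∀ x : Ω → ℝ, Integrable x P → Integrable (fun ω => ((max (x ω) 0 : ℝ) : ℂ) *
        Complex.exp (L ((I.restrict ∘ Φ) ω) * Complex.I)) P := by
      intro x hx
      refine hx.pos_part.ofReal.mul_bdd (c := 1) hm (Eventually.of_forall fun ω => ?_)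
      rw [Complex.norm_exp_ofReal_mul_I]
    have := integral_sub (hint y hy) (hint (fun ω => -y ω) hy.neg)
    refine Eq.trans ?_ (h I fun t => if ht : t ∈ I then L (Pi.single ⟨t, ht⟩ 1) else 0)
    refine this.symm.trans (integral_congr_ae (Eventually.of_forall fun ω => ?_))
    dsimp only
    rw [← hL, ← sub_mul, ← Complex.ofReal_sub]
    congr 2
    rcases le_total (y ω) 0 with h0 | h0
    · rw [max_eq_right h0, max_eq_left (neg_nonneg.2 h0)]; ring
    · rw [max_eq_left h0, max_eq_right (neg_nonpos.2 h0)]; ring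
  -- A finite measure on the product is determined by its finite-dimensional marginals, and these
  -- agree by their characteristic functions.
  have heq : μ₁.map Φ = μ₂.map Φ :=
    IsProjectiveLimit.unique (P := fun I => (μ₁.map Φ).map I.restrict)
      (fun I => rfl) (fun I => (hfin I).symm)
  obtain ⟨B, hB, rfl⟩ := hA
  have hBΩ : MeasurableSet (Φ ⁻¹' B) := hΦ hB
  rw [integral_eq_lintegral_pos_part_sub_lintegral_neg_part hy.integrableOn,
    ← withDensity_apply _ hBΩ, ← withDensity_apply _ hBΩ, ← Measure.map_apply hΦ hB,
    ← Measure.map_apply hΦ hB]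
  change ((μ₁.map Φ) B).toReal - ((μ₂.map Φ) B).toReal = 0
  rw [heq, sub_self]

end CharacteristicFunctions

/-! ### Totality of the renormalized exponentials in `L²(ℱ_∞)` -/

section Totality

variable {Ω : Type*} [mΩ : MeasurableSpace Ω] {P : Measure Ω} {N : ℕ}
  {W : Fin N → ℝ≥0 → Ω → ℝ}

omit mΩ in
lemma sigmaInfty_eq_comap (W : Fin N → ℝ≥0 → Ω → ℝ) : sigmaInfty W =
    MeasurableSpace.comap (fun ω (p : ℝ≥0 × Fin N) => W p.2 p.1 ω) MeasurableSpace.pi := by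
  simp only [sigmaInfty, MeasurableSpace.pi, MeasurableSpace.comap_iSup,
    MeasurableSpace.comap_comp, iSup_prod]
  rw [iSup_comm]
  rfl

namespace IsBrownianMotion

lemma sigmaInfty_le (hW : IsBrownianMotion W P) : sigmaInfty W ≤ mΩ :=
  iSup_le fun μ => iSup_le fun t => (hW.measurable μ t).comap_le

variable [IsProbabilityMeasure P]

lemma integral_exp_mul_eq_zero (hW : IsBrownianMotion W P) {Y : Lp ℂ 2 P}
    (hY : ∀ h, inner ℂ (hW.isIsonormal.wickLp h) Y = 0) (h : L2Δ N) :
    ∫ ω, Y ω * Complex.exp (hW.wiener h ω) ∂P = 0 := by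
  have h1 := hY (conjLp _ h)
  rw [inner_eq_pairing, hW.isIsonormal.conjLp_wickLp, conjLp_conjLp, pairing_eq_integral] at h1
  have h2 : ∀ᵐ ω ∂P, hW.isIsonormal.wickLp h ω * Y ω =
      Complex.exp (-(pairing h h / 2)) * (Y ω * Complex.exp (hW.wiener h ω)) := by
    filter_upwards [hW.isIsonormal.coeFn_wickLp h] with ω hω
    rw [hω, IsIsonormal.wickExp_eq]; ring
  rw [integral_congr_ae h2, integral_const_mul] at h1
  exact (mul_eq_zero.1 h1).resolve_left (Complex.exp_ne_zero _)

/-- A real density is wanted, so the relation for `i v` is added to the conjugate of the one for `-i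
v`: both carry the phase `e^{i U(v)}`, and `Y + Ȳ = 2 Re Y`. -/
lemma integral_re_mul_exp_eq_zero (hW : IsBrownianMotion W P) {Y : Lp ℂ 2 P}
    (hY : ∀ h, inner ℂ (hW.isIsonormal.wickLp h) Y = 0) {v : L2Δ N} (hv : conjLp _ v = v) :
    ∫ ω, ((Y ω).re : ℂ) * Complex.exp ((hW.wiener v ω).re * Complex.I) ∂P = 0 := by
  have hexp : ∀ c : ℂ, ∀ᵐ ω ∂P, Complex.exp (hW.wiener (c • v) ω) =
      Complex.exp (c * (hW.wiener v ω).re) := by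
    intro c
    rw [map_smul]
    filter_upwards [Lp.coeFn_smul c (hW.wiener v), hW.isIsonormal.ae_real hv] with ω h1 h2
    rw [h1, Pi.smul_apply, smul_eq_mul, ← h2]
  have h1 := hW.integral_exp_mul_eq_zero hY (Complex.I • v)
  have h2 := hW.integral_exp_mul_eq_zero hY ((-Complex.I) • v)
  have h3 := congrArg conj h2
  rw [← integral_conj, map_zero] at h3
  have hint : ∀ h, Integrable (fun ω => Y ω * Complex.exp (hW.wiener h ω)) P := fun h =>
    integrable_mul_of_memLp (Lp.memLp Y) (hW.isIsonormal.memLp_exp h)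
  have h4 := integral_add (hint (Complex.I • v))
    (Complex.conjCLE.toContinuousLinearMap.integrable_comp (hint ((-Complex.I) • v)))
  have h5 : ∫ ω, Complex.conjCLE.toContinuousLinearMap
      (Y ω * Complex.exp (hW.wiener ((-Complex.I) • v) ω)) ∂P = 0 := h3
  rw [h1, h5, add_zero] at h4
  have h6 : ∫ ω, 2 * (((Y ω).re : ℂ) *
      Complex.exp ((hW.wiener v ω).re * Complex.I)) ∂P = 0 := by
    rw [← h4]
    refine integral_congr_ae ?_
    filter_upwards [hexp Complex.I, hexp (-Complex.I)] with ω e1 e2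
    have e3 : Complex.conjCLE.toContinuousLinearMap
        (Y ω * Complex.exp (hW.wiener ((-Complex.I) • v) ω)) =
        conj (Y ω) * Complex.exp (Complex.I * (hW.wiener v ω).re) := by
      change conj _ = _
      rw [e2, map_mul, ← Complex.exp_conj, map_mul, map_neg, Complex.conj_I, neg_neg,
        Complex.conj_ofReal]
    rw [e3, e1, ← add_mul, Complex.add_conj, mul_comm Complex.I]
    push_cast
    ring
  rw [integral_const_mul] at h6
  exact (mul_eq_zero.1 h6).resolve_left two_ne_zero

lemma setIntegral_re_eq_zero (hW : IsBrownianMotion W P) {Y : Lp ℂ 2 P}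
    (hY : ∀ h, inner ℂ (hW.isIsonormal.wickLp h) Y = 0) {A : Set Ω}
    (hA : MeasurableSet[sigmaInfty W] A) : ∫ ω in A, (Y ω).re ∂P = 0 := by
  rw [sigmaInfty_eq_comap] at hA
  have hYi : Integrable Y P := (Lp.memLp Y).integrable (by norm_num)
  refine setIntegral_eq_zero_of_integral_exp_eq_zero
    (Z := fun p : ℝ≥0 × Fin N => W p.2 p.1) (fun p => hW.measurable p.2 p.1) hYi.re
    (fun I c => ?_) hA
  set v : L2Δ N := ∑ p ∈ I, (c p : ℂ) • intervalLp 0 p.1 p.2 with hvdef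
  have hv : conjLp _ v = v := by
    rw [hvdef, map_sum]
    refine Finset.sum_congr rfl fun p _ => ?_
    rw [conjLp_smul, Complex.conj_ofReal, conjLp_intervalLp]
  have h2 : ∀ᵐ ω ∂P, ∀ q : I, hW.evalLp q.1 ω = (W q.1.2 q.1.1 ω : ℂ) :=
    ae_all_iff.2 fun q => hW.coeFn_evalLp q.1
  have h3 : ∀ᵐ ω ∂P, ∀ q : I, ((c q.1 : ℂ) • hW.evalLp q.1) ω = (c q.1 : ℂ) * hW.evalLp q.1 ω :=
    ae_all_iff.2 fun q => Lp.coeFn_smul _ _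
  have h4 : ∀ᵐ ω ∂P, (hW.wiener v ω).re = ∑ p ∈ I, c p * W p.2 p.1 ω := by
    rw [hvdef, map_sum]
    simp only [map_smul, wiener_intervalLp_zero]
    filter_upwards [h2, h3, Lp.coeFn_finsetSum I fun q => (c q : ℂ) • hW.evalLp q] with ω h2 h3 h4
    rw [h4, Finset.sum_apply, Complex.re_sum]
    refine Finset.sum_congr rfl fun q hq => ?_
    rw [h3 ⟨q, hq⟩, h2 ⟨q, hq⟩]
    simp
  rw [← hW.integral_re_mul_exp_eq_zero hY hv]
  refine integral_congr_ae ?_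
  filter_upwards [h4] with ω hω
  rw [hω]
  rfl

/-- `Y` need not be `ℱ_∞`-measurable, so it need not vanish; its conditional expectation does, and
an `ℱ_∞`-measurable `X` sees only that projection. -/
lemma inner_eq_zero_of_sigmaInfty (hW : IsBrownianMotion W P) {Y : Lp ℂ 2 P}
    (hY : ∀ h, inner ℂ (hW.isIsonormal.wickLp h) Y = 0) {X : Lp ℂ 2 P}
    (hX : AEStronglyMeasurable[sigmaInfty W] X P) : inner ℂ Y X = 0 := by
  have hYi : Integrable Y P := (Lp.memLp Y).integrable (by norm_num)
  have hset : ∀ A, MeasurableSet[sigmaInfty W] A → ∫ ω in A, Y ω ∂P = 0 := by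
    intro A hA
    have hre := hW.setIntegral_re_eq_zero hY hA
    -- The real part of `-i Y` is the imaginary part of `Y`.
    have hY' : ∀ h, inner ℂ (hW.isIsonormal.wickLp h) ((-Complex.I) • Y) = 0 := fun h => by
      rw [inner_smul_right, hY, mul_zero]
    have him := hW.setIntegral_re_eq_zero hY' hA
    have him' : ∫ ω in A, (Y ω).im ∂P = 0 := by
      rw [← him]
      refine integral_congr_ae (ae_restrict_of_ae ?_)
      filter_upwards [Lp.coeFn_smul (-Complex.I) Y] with ω hω
      rw [hω]; simp
    rw [← integral_re_add_im hYi.integrableOn]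
    change ((∫ ω in A, (Y ω).re ∂P : ℝ) : ℂ) + ((∫ ω in A, (Y ω).im ∂P : ℝ) : ℂ) * _ = 0
    rw [hre, him']
    simp
  have hcond : ((condExpL2 ℂ ℂ hW.sigmaInfty_le Y : Lp ℂ 2 P)) = 0 := by
    refine Lp.eq_zero_iff_ae_eq_zero.2 ?_
    have h1 : P[Y | sigmaInfty W] =ᵐ[P] 0 := by
      refine (ae_eq_condExp_of_forall_setIntegral_eq hW.sigmaInfty_le hYi ?_ ?_ ?_).symm
      · exact fun s _ _ => (integrable_zero _ _ _).integrableOn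
      · intro s hs _
        rw [hset s hs]; simp
      · exact aestronglyMeasurable_zero
    have h2 := (Lp.memLp Y).condExpL2_ae_eq_condExp (𝕜 := ℂ) hW.sigmaInfty_le
    rw [Lp.toLp_coeFn] at h2
    exact h2.trans h1
  rw [← inner_condExpL2_eq_inner_fun hW.sigmaInfty_le Y X hX, hcond, inner_zero_left]

end IsBrownianMotion

end Totality

/-! ### The chaos isometry and its identification with iterated integrals -/

section Chaos

variable {Ω : Type*} [mΩ : MeasurableSpace Ω] {P : Measure Ω} {N : ℕ}
  {W : Fin N → ℝ≥0 → Ω → ℝ}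

lemma pairing_intervalLp_eq_zero {a b c d : ℝ≥0} (hbc : b ≤ c) (μ κ : Fin N) :
    pairing (intervalLp a b μ) (intervalLp c d κ) = 0 := by
  have hm : MeasurableSet (Set.Ioc a b ×ˢ {μ}) :=
    measurableSet_Ioc.prod (measurableSet_singleton _)
  rw [pairing, conjLp_intervalLp, inner_intervalLp,
    integral_congr_ae (g := fun _ => (0 : ℂ)), integral_zero]
  filter_upwards [ae_restrict_of_ae (coeFn_intervalLp c d κ), ae_restrict_mem hm] with x h1 h2
  rw [h1, Set.indicator_of_notMem]
  exact fun h3 => absurd (h3.1.1.trans_le h2.1.2) (not_lt.2 hbc)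

/-- The indicator of an ordered box as a kernel on the ordered region. -/
noncomputable def orderedBoxLp {n : ℕ} (a b : Fin n → ℝ≥0) (μ : Fin n → Fin N) : L2Simplex N n :=
  restrictSimplex N n (tensorLp fun i => intervalLp (a i) (b i) (μ i))

lemma coeFn_orderedBoxLp {n : ℕ} (a b : Fin n → ℝ≥0) (μ : Fin n → Fin N) :
    orderedBoxLp a b μ =ᵐ[(dτPow N n).restrict (simplex N n)]
      (box a b μ).indicator fun _ => (1 : ℂ) :=
  (LpToLpRestrictCLM_coeFn ℂ (simplex N n) _).trans
    (ae_restrict_of_ae (tensorLp_intervalLp a b μ))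

lemma inner_orderedBoxLp {n : ℕ} {a b : Fin n → ℝ≥0} (hab : ∀ i j, i < j → b i ≤ a j)
    (μ : Fin n → Fin N) (g : L2Simplex N n) :
    inner ℂ (orderedBoxLp a b μ) g = ∫ τ in box a b μ, g τ ∂(dτPow N n) := by
  have h1 : inner ℂ (orderedBoxLp a b μ) g =
      ∫ τ in simplex N n, (box a b μ).indicator g τ ∂(dτPow N n) := by
    rw [L2.inner_def]
    refine integral_congr_ae ?_
    filter_upwards [coeFn_orderedBoxLp a b μ] with τ h
    rw [h]
    by_cases hτ : τ ∈ box a b μ <;> simp [hτ]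
  rw [h1, integral_indicator (measurableSet_box a b μ),
    Measure.restrict_restrict (measurableSet_box a b μ),
    Set.inter_eq_left.2 (box_subset_simplex hab μ)]

lemma inner_simplexPow_orderedBoxLp {n : ℕ} {a b : Fin n → ℝ≥0}
    (hab : ∀ i j, i < j → b i ≤ a j) (μ : Fin n → Fin N) (h : L2Δ N) :
    inner ℂ (simplexPow n h) (orderedBoxLp a b μ) =
      ∏ i, inner ℂ h (intervalLp (a i) (b i) (μ i)) := by
  rw [← inner_tensorLp (fun _ => h), ← inner_conj_symm, inner_orderedBoxLp hab,
    ← inner_conj_symm (tensorLp fun _ => h)]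
  congr 1
  have hsub := box_subset_simplex hab μ
  rw [L2.inner_def, ← integral_indicator (measurableSet_box a b μ)]
  have h0 := (ae_restrict_iff' (measurableSet_simplex n)).1 (coeFn_simplexPow (n := n) h)
  refine integral_congr_ae ?_
  filter_upwards [h0, coeFn_tensorLp fun _ : Fin n => h, tensorLp_intervalLp a b μ] with τ h1 h2 h3
  rw [h3, h2]
  by_cases hτ : τ ∈ box a b μ
  · simp [hτ, h1 (hsub hτ)]
  · simp [hτ]

lemma span_orderedBoxLp (n : ℕ) : (Submodule.span ℂ
    {f : L2Simplex N n | ∃ a b μ, (∀ i, a i ≤ b i) ∧ (∀ i j, i < j → b i ≤ a j) ∧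
      f = orderedBoxLp a b μ}).topologicalClosure = ⊤ := by
  refine span_closure_eq_top_of_orthogonal fun g hg => Lp.eq_zero_iff_ae_eq_zero.2 ?_
  refine ae_eq_zero_of_integral_ordered_box_eq_zero (Lp.memLp g) fun a b μ h1 h2 => ?_
  rw [← inner_orderedBoxLp h2]
  exact hg _ ⟨a, b, μ, h1, h2, rfl⟩

namespace IsBrownianMotion

variable [IsProbabilityMeasure P]

lemma exists_chaos (hW : IsBrownianMotion W P) : ∃ V : Fock N →ₗᵢ[ℂ] Lp ℂ 2 P,
    ∀ h, V (expVec h) = hW.isIsonormal.wickLp h :=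
  exists_linearIsometry_of_inner_eq
    (fun g h => by rw [hW.isIsonormal.inner_wickLp, inner_expVec]) span_expVec

/-- The chaos isometry from the Fock space to `L²(P)`. -/
noncomputable def chaos (hW : IsBrownianMotion W P) : Fock N →ₗᵢ[ℂ] Lp ℂ 2 P :=
  hW.exists_chaos.choose

lemma chaos_expVec (hW : IsBrownianMotion W P) (h : L2Δ N) :
    hW.chaos (expVec h) = hW.isIsonormal.wickLp h :=
  hW.exists_chaos.choose_spec h

/-- An isometric image of a complete space is closed, hence equal to its double orthogonal
complement, to which `X` belongs by totality. -/
lemma exists_chaos_eq (hW : IsBrownianMotion W P) {X : Lp ℂ 2 P}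
    (hX : AEStronglyMeasurable[sigmaInfty W] X P) : ∃ G, hW.chaos G = X := by
  have hclosed : IsClosed (LinearMap.range hW.chaos.toLinearMap : Set (Lp ℂ 2 P)) := by
    rw [LinearMap.coe_range]
    exact hW.chaos.isometry.isClosedEmbedding.isClosed_range
  have hmem : X ∈ (LinearMap.range hW.chaos.toLinearMap)ᗮᗮ := by
    intro Y hY
    refine hW.inner_eq_zero_of_sigmaInfty (fun h => ?_) hX
    rw [← hW.chaos_expVec]
    exact hY _ ⟨_, rfl⟩
  rw [Submodule.orthogonal_orthogonal_eq_closure, hclosed.submodule_topologicalClosure_eq] at hmem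
  exact hmem

/-- Successive intervals give orthogonal indicators, so the correlation with an exponential
factorizes and the normalization of `wickLp` cancels the Gaussian factor. -/
lemma inner_wickLp_prod (hW : IsBrownianMotion W P) {n : ℕ} {a b : Fin n → ℝ≥0}
    {μ : Fin n → Fin N} (hab : ∀ i, a i ≤ b i) (hord : ∀ i j, i < j → b i ≤ a j) {y : Lp ℂ 2 P}
    (hy : y =ᵐ[P] fun ω => ∏ i, ((W (μ i) (b i) ω - W (μ i) (a i) ω : ℝ) : ℂ)) (h : L2Δ N) :
    inner ℂ (hW.isIsonormal.wickLp h) y =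
      ∏ i, inner ℂ h (intervalLp (a i) (b i) (μ i)) := by
  have hU := hW.isIsonormal
  set e : Fin n → L2Δ N := fun i => intervalLp (a i) (b i) (μ i) with he
  have horth : ∀ i j, i ≠ j → pairing (e i) (e j) = 0 := by
    intro i j hij
    rcases lt_or_gt_of_ne hij with h | h
    · exact pairing_intervalLp_eq_zero (hord i j h) _ _
    · rw [pairing_comm]; exact pairing_intervalLp_eq_zero (hord j i h) _ _
  have key := hU.integral_prod_mul_exp (fun i => conjLp_intervalLp _ _ _) horth
    Finset.univ (conjLp _ h)
  have hprod : ∀ᵐ ω ∂P, ∀ i, hW.wiener (e i) ω = ((W (μ i) (b i) ω - W (μ i) (a i) ω : ℝ) : ℂ) :=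
    ae_all_iff.2 fun i => hW.coeFn_wiener_intervalLp (hab i) (μ i)
  have h1 : ∀ᵐ ω ∂P, hU.wickLp (conjLp _ h) ω * y ω =
      Complex.exp (-(pairing (conjLp _ h) (conjLp _ h) / 2)) *
        ((∏ i, hW.wiener (e i) ω) * Complex.exp (hW.wiener (conjLp _ h) ω)) := by
    filter_upwards [hU.coeFn_wickLp (conjLp _ h), hy, hprod] with ω h1 h2 h3
    rw [h1, h2, IsIsonormal.wickExp_eq]
    simp only [h3]
    ring
  rw [inner_eq_pairing, hU.conjLp_wickLp, pairing_eq_integral, integral_congr_ae h1,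
    integral_const_mul, key, mul_left_comm, ← Complex.exp_add, neg_add_cancel, Complex.exp_zero,
    mul_one]
  refine Finset.prod_congr rfl fun i _ => ?_
  rw [pairing_comm, ← inner_eq_pairing]

/-- The product of increments is `ℱ_∞`-measurable, hence of the form `V G`. Both `G` and the box
kernel have the inner product `∏ᵢ ⟨h, 1ᵢ⟩` with every exponential vector `e(h)`, where `1ᵢ` is the
indicator of the `i`-th side, so they coincide. -/
lemma chaos_single_orderedBoxLp (hW : IsBrownianMotion W P) {n : ℕ} {a b : Fin n → ℝ≥0}
    {μ : Fin n → Fin N} (hab : ∀ i, a i ≤ b i) (hord : ∀ i j, i < j → b i ≤ a j) {y : Lp ℂ 2 P}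
    (hy : y =ᵐ[P] fun ω => ∏ i, ((W (μ i) (b i) ω - W (μ i) (a i) ω : ℝ) : ℂ)) :
    hW.chaos (lp.single 2 n (orderedBoxLp a b μ)) = y := by
  have hmeas : AEStronglyMeasurable[sigmaInfty W] y P := by
    refine ⟨_, Measurable.stronglyMeasurable ?_, hy⟩
    have hWm : ∀ κ t, Measurable[sigmaInfty W] (W κ t) := fun κ t =>
      (comap_measurable (W κ t)).mono (le_iSup₂_of_le κ t le_rfl) le_rfl
    refine Finset.measurable_fun_prod _ fun i _ => ?_
    exact Complex.measurable_ofReal.comp ((hWm _ _).sub (hWm _ _))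
  obtain ⟨G, hG⟩ := hW.exists_chaos_eq hmeas
  have hz : lp.single 2 n (orderedBoxLp a b μ) - G = 0 := by
    refine eq_zero_of_inner_expVec_eq_zero fun h => ?_
    rw [inner_sub_right, lp.inner_single_right, expVec_apply, inner_simplexPow_orderedBoxLp hord,
      ← hW.chaos.inner_map_map (expVec h) G, hG, hW.chaos_expVec,
      hW.inner_wickLp_prod hab hord hy, sub_self]
  rw [sub_eq_zero.1 hz, hG]

lemma iteratedIntegral_eq (hW : IsBrownianMotion W P) (n : ℕ) (g : L2Simplex N n) :
    iteratedIntegral W P n g = hW.chaos (lp.single 2 n g) := by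
  let I : L2Simplex N n →L[ℂ] Lp ℂ 2 P := hW.chaos.toContinuousLinearMap.comp
    ⟨lp.lsingle (𝕜 := ℂ) (E := fun n => L2Simplex N n) 2 n,
      (lp.isometry_single (E := fun n => L2Simplex N n) n).continuous⟩
  refine closedExtension_eq I ?_ ?_ g
  · rintro ⟨f, y⟩ ⟨a, b, μ, hab, hord, hf, hy⟩
    have hf' : f = orderedBoxLp a b μ := by
      ext1; exact hf.trans (coeFn_orderedBoxLp a b μ).symm
    subst hf'
    exact (hW.chaos_single_orderedBoxLp hab hord hy).symm
  · rw [eq_top_iff, ← span_orderedBoxLp]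
    refine Submodule.topologicalClosure_mono (Submodule.span_mono ?_)
    rintro _ ⟨a, b, μ, hab, hord, rfl⟩
    have hmem : MemLp (fun ω => ∏ i, ((W (μ i) (b i) ω - W (μ i) (a i) ω : ℝ) : ℂ)) 2 P := by
      refine (memLp_congr_ae ?_).1 (hW.isIsonormal.memLp_prod (e := fun i =>
        intervalLp (a i) (b i) (μ i)) fun i => conjLp_intervalLp _ _ _)
      filter_upwards [ae_all_iff.2 fun i => hW.coeFn_wiener_intervalLp (hab i) (μ i)] with ω hω
      exact Finset.prod_congr rfl fun i _ => hω i
    exact ⟨(orderedBoxLp a b μ, hmem.toLp), ⟨a, b, μ, hab, hord, coeFn_orderedBoxLp a b μ,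
      hmem.coeFn_toLp⟩, rfl⟩

/-- Convergence alone is assumed of `g`, not membership in the Fock space. Pairing with the image of
a vector of degree `m` is continuous and isolates the `m`-th kernel. -/
lemma hasSum_iteratedIntegral_iff (hW : IsBrownianMotion W P) (G : Fock N)
    (g : ∀ n, L2Simplex N n) :
    HasSum (fun n => iteratedIntegral W P n (g n)) (hW.chaos G) ↔ ∀ n, g n = G n := by
  simp only [hW.iteratedIntegral_eq]
  constructor
  · intro h m
    refine ext_inner_left ℂ fun k => ?_
    have h1 := h.mapL (innerSL ℂ (hW.chaos (lp.single 2 m k)))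
    simp only [innerSL_apply_apply, hW.chaos.inner_map_map, lp.inner_single_left] at h1
    have h2 := hasSum_single (f := fun n => inner ℂ k ((lp.single 2 n (g n) : Fock N) m)) m
      (fun n hn => by rw [lp.single_apply_ne _ _ _ hn.symm, inner_zero_right])
    rw [lp.single_apply_self] at h2
    exact h2.unique h1
  · intro h
    have h1 : HasSum (fun n => lp.single 2 n (G n)) G := lp.hasSum_single (by norm_num) G
    simp only [h]
    exact h1.mapL hW.chaos.toContinuousLinearMap

lemma generatingIntegrand_ae_eq (hW : IsBrownianMotion W P) (X : Lp ℂ 2 P) (h : L2Δ N) :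
    generatingIntegrand W P X h =ᵐ[P] fun ω => hW.isIsonormal.wickLp h ω * X ω := by
  filter_upwards [hW.isIsonormal.coeFn_wickLp h] with ω hω
  rw [hω, generatingIntegrand, hW.wienerIntegral_eq, IsIsonormal.wickExp, pairing_eq_integral,
    mul_comm]
  congr 3
  simp only [sq]
  ring

lemma integrable_generatingIntegrand (hW : IsBrownianMotion W P) (X : Lp ℂ 2 P) (h : L2Δ N) :
    Integrable (generatingIntegrand W P X h) P :=
  (integrable_mul_of_memLp (Lp.memLp _) (Lp.memLp X)).congr
    (hW.generatingIntegrand_ae_eq X h).symm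

/-- `Z_X(h)` is the bilinear pairing of `ℰ(h)` with `X`, that is `⟨ℰ(h̄), X⟩`, which the isometry
transports to the Fock space. -/
lemma generatingFunctional_chaos (hW : IsBrownianMotion W P) (G : Fock N) :
    generatingFunctional W P (hW.chaos G) = fun h => inner ℂ (expVec (conjLp _ h)) G := by
  ext h
  rw [generatingFunctional, integral_congr_ae (hW.generatingIntegrand_ae_eq _ h),
    ← pairing_eq_integral, pairing, hW.isIsonormal.conjLp_wickLp, ← hW.chaos_expVec,
    hW.chaos.inner_map_map]

end IsBrownianMotion

end Chaos

end WienerChaos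

/-! ### The generating functional theorem -/

theorem theorem2p1 {Ω : Type*} [MeasurableSpace Ω] (P : Measure Ω) [IsProbabilityMeasure P]
    (N : ℕ) (W : Fin N → ℝ≥0 → Ω → ℝ) (hW : WienerChaos.IsBrownianMotion W P)
    (X : Lp ℂ 2 P) (hX : AEStronglyMeasurable[WienerChaos.sigmaInfty W] X P) :
    (∀ h : WienerChaos.L2Δ N, Integrable (WienerChaos.generatingIntegrand W P X h) P) ∧
    AnalyticOnNhd ℂ (WienerChaos.generatingFunctional W P X) Set.univ ∧
    ∃ f : ∀ n, WienerChaos.L2Pow N n,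
      (∀ (n : ℕ) (k : WienerChaos.L2Pow N n),
        WienerChaos.IsFrechetKernel (WienerChaos.generatingFunctional W P X) n k ↔ k = f n) ∧
      (∀ h : WienerChaos.L2Δ N,
        Summable (fun n =>
          ‖WienerChaos.taylorTerm (WienerChaos.restrictSimplex N n (f n)) h‖) ∧
        HasSum (fun n => WienerChaos.taylorTerm (WienerChaos.restrictSimplex N n (f n)) h)
          (WienerChaos.generatingFunctional W P X h)) ∧
      (∀ g : ∀ n, WienerChaos.L2Simplex N n,
        HasSum (fun n => WienerChaos.iteratedIntegral W P n (g n)) X ↔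
          ∀ n, g n = WienerChaos.restrictSimplex N n (f n)) := by
  -- Everything is read off from the Fock vector `G` of `X`; the derivative kernels are the
  -- symmetric extensions of its components, and restricting them to `Δ_n` returns `G n`.
  obtain ⟨G, rfl⟩ := hW.exists_chaos_eq hX
  refine ⟨hW.integrable_generatingIntegrand _, ?_, fun n => WienerChaos.symExt (G n), ?_, ?_, ?_⟩
  · rw [hW.generatingFunctional_chaos]
    have := (WienerChaos.hasFPowerSeriesOnBall_kernelSeries G).analyticOnNhd
    rwa [Metric.eball_top] at this
  · intro n k
    rw [WienerChaos.IsFrechetKernel, hW.generatingFunctional_chaos]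
    simp only [WienerChaos.iteratedFDeriv_inner_expVec]
    exact ⟨fun h => WienerChaos.L2Pow_ext fun v => (h v).symm, fun h v => by rw [h]⟩
  · intro h
    simp only [WienerChaos.restrictSimplex_symExt, hW.generatingFunctional_chaos]
    have := WienerChaos.hasSum_taylorTerm G h
    exact ⟨this.summable.norm, this⟩
  · intro g
    simp only [WienerChaos.restrictSimplex_symExt]
    exact hW.hasSum_iteratedIntegral_iff G g
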